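/- Let $T\ge 1$ and $N_1,\dots,N_T\ge 1$ be integers. For $1\le t\le T$ let $\mu_t$ be a probability measure on a measurable space $\mathcal X_t$, and let $(X_t^i)_{1\le t\le T,\,1\le i\le N_t}$ be independent random variables such that $X_t^i$ has distribution $\mu_t$. Let $\boldsymbol{\mathcal F}$ be a non-empty class of vector-valued functions $\boldsymbol f=(f_1,\dots,f_T)$ with measurable components $f_t:\mathcal X_t\to\mathbb R$. Assume that $\boldsymbol{\mathcal F}$ is pointwise measurable: there is a countable $\boldsymbol{\mathcal G}\subset\boldsymbol{\mathcal F}$ such that for every $\boldsymbol f\in\boldsymbol{\mathcal F}$ there is a sequence $(\boldsymbol g_m)$ in $\boldsymbol{\mathcal G}$ with $g_{m,t}(z)\to f_t(z)$ for all $t$ and all $z\in\mathcal X_t$. Assume also that $|f_t(z)|\le b$ for all $\boldsymbol f\in\boldsymbol{\mathcal F}$, all $t$ and all $z\in\mathcal X_t$, and that $\sup_{\boldsymbol f\in\boldsymbol{\mathcal F}}\frac1T\sum_{t=1}^T \mathrm{Var}(f_t(X_t^1))\le r$. Put $n=\min_{1\le t\le T}N_t$, $$P\boldsymbol f=\frac1T\sum_{t=1}^T\mathbb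 E[f_t(X_t^1)],\qquad P_N\boldsymbol f=\frac1T\sum_{t=1}^T\frac1{N_t}\sum_{i=1}^{N_t}f_t(X_t^i),$$ $$\mathcal R(\boldsymbol{\mathcal F})=\mathbb E_{X,\sigma}\Big[\sup_{\boldsymbol f\in\boldsymbol{\mathcal F}}\frac1T\sum_{t=1}^T\frac1{N_t}\sum_{i=1}^{N_t}\sigma_t^i f_t(X_t^i)\Big],$$ where the $\sigma_t^i$ are independent Rademacher variables (uniform on $\{-1,1\}$), independent of the $X_t^i$. Then for every $x>0$, with probability at least $1-e^{-x}$, $$\sup_{\boldsymbol f\in\boldsymbol{\mathcal F}}(P\boldsymbol f-P_N\boldsymbol f)\le\inf_{\alpha>0}\left(2(1+\alpha)\mathcal R(\boldsymbol{\mathcal F})+2\sqrt{\frac{xr}{nT}}+\Big(1+\frac4\alpha\Big)\frac{bx}{nT}\right).$$ Likewise, with probability at least $1-e^{-x}$, the same bound holds for $\sup_{\boldsymbol f\in\boldsymbol{\mathcal F}}(P_N\boldsymbol f-P\boldsymbol f)$. -/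

import Mathlib

open MeasureTheory ProbabilityTheory Filter Topology
open scoped BigOperators ENNReal

noncomputable section

namespace MTL

variable {T : ℕ} {𝒳 : Fin T → Type*} {N : Fin T → ℕ}

/-- The expectation `P f = (1/T) ∑ₜ ∫ fₜ dμₜ` of a vector-valued function `f = (f₁, …, f_T)`. -/
def mean [∀ t, MeasurableSpace (𝒳 t)] (μ : ∀ t, Measure (𝒳 t)) (f : ∀ t, 𝒳 t → ℝ) : ℝ :=
  (1 / (T : ℝ)) * ∑ t, ∫ z, f t z ∂(μ t)

/-- The empirical part `P_N f = (1/T) ∑ₜ (1/Nₜ) ∑ᵢ fₜ(zₜⁱ)` of a vector-valued function, at the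
sample `z = (zₜⁱ)`, with `Nₜ` points for task `t`. -/
def empMean (z : ∀ t, Fin (N t) → 𝒳 t) (f : ∀ t, 𝒳 t → ℝ) : ℝ :=
  (1 / (T : ℝ)) * ∑ t, (1 / (N t : ℝ)) * ∑ i, f t (z t i)

/-- The Rademacher distribution: mass `1/2` at each of `1` and `-1`. -/
def rademacherLaw : Measure ℝ :=
  (2⁻¹ : ℝ≥0∞) • Measure.dirac (1 : ℝ) + (2⁻¹ : ℝ≥0∞) • Measure.dirac (-1 : ℝ)

instance : IsProbabilityMeasure rademacherLaw :=
  ⟨by simp [rademacherLaw, ENNReal.inv_two_add_inv_two]⟩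

/-- The multi-task Rademacher complexity
`R(F) = E_{X,σ} sup_{f ∈ F} (1/T) ∑ₜ (1/Nₜ) ∑ᵢ σₜⁱ fₜ(Xₜⁱ)` of a class `F` of vector-valued
functions. The `σₜⁱ` are independent Rademacher variables, independent of the sample `X`: they
are the coordinates of the second factor of the product probability space. -/
def rademacherComplexity {Ω : Type*} [MeasurableSpace Ω] (Pr : Measure Ω)
    (X : ∀ t, Fin (N t) → Ω → 𝒳 t) (F : Set (∀ t, 𝒳 t → ℝ)) : ℝ :=
  ∫ p : Ω × ((Σ t, Fin (N t)) → ℝ),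
    (⨆ f : F, (1 / (T : ℝ)) * ∑ t, (1 / (N t : ℝ)) *
      ∑ i, p.2 ⟨t, i⟩ * (f : ∀ t, 𝒳 t → ℝ) t (X t i p.1))
    ∂(Pr.prod (Measure.pi fun _ : (Σ t, Fin (N t)) => rademacherLaw))

/-- A class `F` of vector-valued functions with measurable components is pointwise measurable if
it has a countable subset `G` such that each `f ∈ F` is the pointwise limit of a sequence
in `G`. -/
def PointwiseMeasurable [∀ t, MeasurableSpace (𝒳 t)] (F : Set (∀ t, 𝒳 t → ℝ)) : Prop :=
  (∀ f ∈ F, ∀ t, Measurable (f t)) ∧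
  ∃ G : Set (∀ t, 𝒳 t → ℝ), G ⊆ F ∧ G.Countable ∧
    ∀ f ∈ F, ∃ g : ℕ → (∀ t, 𝒳 t → ℝ), (∀ m, g m ∈ G) ∧
      ∀ t z, Tendsto (fun m => g m t z) atTop (𝓝 (f t z))

end MTL

end

set_option linter.unusedSectionVars false

namespace MTL

/-! The core is a Talagrand inequality for sums of independent, not identically distributed
variables, proved by the entropy method. Let Z be the maximum of finitely many sums of independent
centered variables bounded above by 1, and L its cumulant generating function. Entropy tensorizes
over a product measure (`entropy_tensorization`), so one coordinate can be treated at a time. There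
(`entropy_exp_iSup_le`), comparing exp(tZ) with a mixture of the exponentials of the single
competitors bounds the entropy by variances plus the increments of a maximizer. Summed over the
coordinates these increments rebuild Z, the terms t²L' cancel, and tL' - (1+t)L ≤ t²eᵗσ²/2 remains,
that is, (e⁻ᵗL/t)' ≤ σ²/2. Integration from 0 (`cgf_le_of_entropy_le`) and Chernoff's bound give
`measure_lt_maxSum_le`: up to probability e⁻ˣ, and after rescaling to the bound M, Z ≤ E + Mx/2 +
2√(x(ME + σ²)) for any E above the mean of Z.

For the class, the point (t, i) has weight 1/(T Nₜ) ≤ 1/(nT), so that M = 2b/(nT) and σ² = r/(nT);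
symmetrization (`integral_maxSum_le_rademacherComplexity`) allows E = 2R. Splitting the square root
with the parameter α yields the stated form. None of these bounds depends on the size of the finite
subfamily, so they pass to the countable subclass by monotone continuity and to the whole class by
pointwise limits. -/

/-! ### Bounded measurable functions: closure properties. -/

/-- Bounded measurable real functions. -/
structure BddMeas {Y : Type*} [MeasurableSpace Y] (f : Y → ℝ) : Prop where
  meas : Measurable f
  bdd : ∃ C, ∀ y, |f y| ≤ C

namespace BddMeas

variable {Y Y' : Type*} [MeasurableSpace Y] [MeasurableSpace Y'] {f g : Y → ℝ}

lemma integrable (hf : BddMeas f) (ν : Measure Y) [IsFiniteMeasure ν] : Integrable f ν := by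
  obtain ⟨C, hC⟩ := hf.bdd
  exact Integrable.of_bound hf.meas.aestronglyMeasurable C (Eventually.of_forall hC)

lemma const (c : ℝ) : BddMeas (fun _ : Y => c) := ⟨measurable_const, |c|, fun _ => le_rfl⟩

lemma add (hf : BddMeas f) (hg : BddMeas g) : BddMeas (fun y => f y + g y) := by
  obtain ⟨C, hC⟩ := hf.bdd
  obtain ⟨D, hD⟩ := hg.bdd
  exact ⟨hf.meas.add hg.meas, C + D, fun y => (abs_add_le _ _).trans (add_le_add (hC y) (hD y))⟩

lemma neg (hf : BddMeas f) : BddMeas (fun y => -f y) := by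
  obtain ⟨C, hC⟩ := hf.bdd
  exact ⟨hf.meas.neg, C, fun y => by rw [abs_neg]; exact hC y⟩

lemma sub (hf : BddMeas f) (hg : BddMeas g) : BddMeas (fun y => f y - g y) := by
  simpa only [sub_eq_add_neg] using hf.add hg.neg

lemma mul (hf : BddMeas f) (hg : BddMeas g) : BddMeas (fun y => f y * g y) := by
  obtain ⟨C, hC⟩ := hf.bdd
  obtain ⟨D, hD⟩ := hg.bdd
  refine ⟨hf.meas.mul hg.meas, C * D, fun y => ?_⟩
  rw [abs_mul]
  exact mul_le_mul (hC y) (hD y) (abs_nonneg _) ((abs_nonneg _).trans (hC y))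

lemma const_mul (c : ℝ) (hf : BddMeas f) : BddMeas (fun y => c * f y) := (const c).mul hf

lemma exp (hf : BddMeas f) : BddMeas (fun y => Real.exp (f y)) := by
  obtain ⟨C, hC⟩ := hf.bdd
  refine ⟨hf.meas.exp, Real.exp C, fun y => ?_⟩
  rw [abs_of_pos (Real.exp_pos _)]
  exact Real.exp_le_exp.2 ((le_abs_self _).trans (hC y))

lemma sum {ι : Type*} (s : Finset ι) {f : ι → Y → ℝ} (hf : ∀ i, BddMeas (f i)) :
    BddMeas (fun y => ∑ i ∈ s, f i y) := by
  classical
  induction s using Finset.induction with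
  | empty => simpa using const 0
  | insert a s ha ih =>
    simp only [Finset.sum_insert ha]
    exact (hf a).add ih

lemma comp (hf : BddMeas f) {g : Y' → Y} (hg : Measurable g) : BddMeas (fun y => f (g y)) := by
  obtain ⟨C, hC⟩ := hf.bdd
  exact ⟨hf.meas.comp hg, C, fun y => hC _⟩

lemma iSup {ι : Type*} [Finite ι] [Nonempty ι] {f : ι → Y → ℝ} (hf : ∀ i, BddMeas (f i)) :
    BddMeas (fun y => ⨆ i, f i y) := by
  choose C hC using fun i => (hf i).bdd
  obtain ⟨D, hD⟩ := (Set.finite_range C).bddAbove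
  refine ⟨Measurable.iSup fun i => (hf i).meas, D, fun y => ?_⟩
  obtain ⟨i, hi⟩ := exists_eq_ciSup_of_finite (f := fun i => f i y)
  rw [← hi]
  exact (hC i y).trans (hD ⟨i, rfl⟩)

lemma integral_right {f : Y → Y' → ℝ} (hf : BddMeas (fun p : Y × Y' => f p.1 p.2))
    (ν : Measure Y') [IsProbabilityMeasure ν] : BddMeas (fun y => ∫ z, f y z ∂ν) := by
  obtain ⟨C, hC⟩ := hf.bdd
  refine ⟨(hf.meas.stronglyMeasurable.integral_prod_right').measurable, C, fun y => ?_⟩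
  have h := norm_integral_le_of_norm_le_const (μ := ν) (f := f y) (C := C)
    (Eventually.of_forall fun z => hC (y, z))
  simpa using h

lemma log_of_exp_le (hf : BddMeas f) {c : ℝ} (hc : ∀ y, Real.exp c ≤ f y) :
    BddMeas (fun y => Real.log (f y)) := by
  obtain ⟨C, hC⟩ := hf.bdd
  refine ⟨hf.meas.log, max (-c) (Real.log C), fun y => ?_⟩
  have h0 := (Real.exp_pos c).trans_le (hc y)
  rw [abs_le']
  constructor
  · exact (Real.log_le_log h0 ((le_abs_self _).trans (hC y))).trans (le_max_right _ _)
  · have := (Real.le_log_iff_exp_le h0).2 (hc y)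
    exact (neg_le_neg this).trans (le_max_left _ _)

end BddMeas

/-! ### Tensorization of entropy under a product measure. -/

section Product

variable {K : Type*} [Fintype K] [DecidableEq K] {Y : K → Type*} [∀ k, MeasurableSpace (Y k)]
  (ν : ∀ k, Measure (Y k)) [∀ k, IsProbabilityMeasure (ν k)]

lemma measurable_update_prod (k : K) :
    Measurable (fun p : (∀ k, Y k) × Y k => Function.update p.1 k p.2) := by
  refine measurable_pi_iff.2 fun j => ?_
  by_cases h : j = k
  · subst h; simpa using measurable_snd
  · simpa [Function.update_of_ne h, Function.comp_def] using
      (measurable_pi_apply j).comp (measurable_fst (α := ∀ k, Y k) (β := Y k))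

/-- Resampling one coordinate preserves a product measure. -/
lemma measurePreserving_update (k : K) :
    MeasurePreserving (fun p : (∀ k, Y k) × Y k => Function.update p.1 k p.2)
      ((Measure.pi ν).prod (ν k)) (Measure.pi ν) := by
  refine ⟨measurable_update_prod k, (Measure.pi_eq fun s hs => ?_).symm⟩
  rw [Measure.map_apply (measurable_update_prod k) (MeasurableSet.univ_pi hs)]
  have : (fun p : (∀ k, Y k) × Y k => Function.update p.1 k p.2) ⁻¹' (Set.univ.pi s)
      = (Set.univ.pi (Function.update s k Set.univ)) ×ˢ s k := by
    ext p
    simp only [Set.mem_preimage, Set.mem_univ_pi, Set.mem_prod]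
    constructor
    · intro h
      refine ⟨fun j => ?_, by simpa using h k⟩
      by_cases hj : j = k
      · subst hj; simp
      · simpa [Function.update_of_ne hj] using h j
    · rintro ⟨h1, h2⟩ j
      by_cases hj : j = k
      · subst hj; simpa using h2
      · simpa [Function.update_of_ne hj] using h1 j
  rw [this, Measure.prod_prod, Measure.pi_pi, ← Finset.mul_prod_erase _ _ (Finset.mem_univ k),
    ← Finset.mul_prod_erase (a := k) (f := fun i => ν i (s i)) _ (Finset.mem_univ k)]
  simp only [Function.update_self, measure_univ, one_mul]
  rw [mul_comm]
  congr 1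
  refine Finset.prod_congr rfl fun j hj => ?_
  rw [Function.update_of_ne (Finset.ne_of_mem_erase hj)]

/-- The integral over the single coordinate `k`. -/
noncomputable def coordInt (k : K) (f : (∀ k, Y k) → ℝ) (x : ∀ k, Y k) : ℝ :=
  ∫ y, f (Function.update x k y) ∂(ν k)

variable {ν}

lemma BddMeas.coordInt {f : (∀ k, Y k) → ℝ} (hf : BddMeas f) (k : K) :
    BddMeas (coordInt ν k f) :=
  BddMeas.integral_right (f := fun x y => f (Function.update x k y))
    (hf.comp (measurable_update_prod k)) (ν k)

lemma integral_coordInt {f : (∀ k, Y k) → ℝ} (hf : BddMeas f) (k : K) :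
    ∫ x, coordInt ν k f x ∂(Measure.pi ν) = ∫ x, f x ∂(Measure.pi ν) := by
  unfold MTL.coordInt
  rw [← (measurePreserving_update ν k).map_eq, integral_map
    (measurable_update_prod k).aemeasurable hf.meas.aestronglyMeasurable,
    (measurePreserving_update ν k).map_eq]
  exact (integral_prod _ ((hf.comp (measurable_update_prod k)).integrable _)).symm

/-- The logarithm of the integral of `exp h` over the coordinate `k`. -/
noncomputable def coordLogInt (ν : ∀ k, Measure (Y k)) (k : K) (h : (∀ k, Y k) → ℝ)
    (x : ∀ k, Y k) : ℝ :=
  Real.log (MTL.coordInt ν k (fun z => Real.exp (h z)) x)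

/-- The uniform positive lower bound keeps the logarithm in `coordLogInt` bounded and away from its
default value at 0. -/
lemma exp_le_coordInt_exp {h : (∀ k, Y k) → ℝ} (hh : BddMeas h) (k : K) :
    ∃ c, ∀ x, Real.exp c ≤ coordInt ν k (fun z => Real.exp (h z)) x := by
  obtain ⟨C, hC⟩ := hh.bdd
  refine ⟨-C, fun x => ?_⟩
  have h1 : ∫ _y : Y k, Real.exp (-C) ∂(ν k) = Real.exp (-C) := by simp
  rw [← h1]
  refine integral_mono (integrable_const _)
    (((hh.exp.comp (measurable_update_prod k)).comp
      (measurable_const.prodMk measurable_id)).integrable (ν k)) fun y => ?_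
  exact Real.exp_le_exp.2 (neg_le_of_abs_le (hC _))

lemma BddMeas.coordLogInt {h : (∀ k, Y k) → ℝ} (hh : BddMeas h) (k : K) :
    BddMeas (coordLogInt ν k h) := by
  obtain ⟨c, hc⟩ := exp_le_coordInt_exp (ν := ν) hh k
  exact (hh.exp.coordInt k).log_of_exp_le hc

lemma exp_coordLogInt {h : (∀ k, Y k) → ℝ} (hh : BddMeas h) (k : K) (x : ∀ k, Y k) :
    Real.exp (coordLogInt ν k h x) = coordInt ν k (fun z => Real.exp (h z)) x := by
  obtain ⟨c, hc⟩ := exp_le_coordInt_exp (ν := ν) hh k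
  exact Real.exp_log ((Real.exp_pos c).trans_le (hc x))

lemma coordInt_update (k : K) (f : (∀ k, Y k) → ℝ) (x : ∀ k, Y k) (y : Y k) :
    coordInt ν k f (Function.update x k y) = coordInt ν k f x := by
  simp [coordInt]

lemma coordInt_update_of_invariant {j : K} (k : K) {f : (∀ k, Y k) → ℝ}
    (hf : ∀ x y, f (Function.update x j y) = f x) (x : ∀ k, Y k) (y : Y j) :
    coordInt ν k f (Function.update x j y) = coordInt ν k f x := by
  by_cases h : k = j
  · subst h; exact coordInt_update k f x y
  · simp only [MTL.coordInt]
    congr 1; ext z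
    rw [Function.update_comm (Ne.symm h), hf]

lemma coordInt_mul_left (k : K) {f g : (∀ k, Y k) → ℝ}
    (hf : ∀ x y, f (Function.update x k y) = f x) (x : ∀ k, Y k) :
    coordInt ν k (fun z => f z * g z) x = f x * coordInt ν k g x := by
  simp only [MTL.coordInt, hf]
  rw [integral_const_mul]

/-- Successive application of `coordLogInt` along a list of coordinates. -/
noncomputable def listLogInt (ν : ∀ k, Measure (Y k)) (l : List K) (h : (∀ k, Y k) → ℝ) :
    (∀ k, Y k) → ℝ :=
  l.foldr (fun k g => MTL.coordLogInt ν k g) h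

lemma BddMeas.listLogInt {h : (∀ k, Y k) → ℝ} (hh : BddMeas h) (l : List K) :
    BddMeas (listLogInt ν l h) := by
  induction l with
  | nil => exact hh
  | cons k l ih => exact BddMeas.coordLogInt ih k

/-- Taking the exponential undoes each logarithm, so every step only integrates out one more
coordinate. -/
lemma integral_exp_listLogInt {h : (∀ k, Y k) → ℝ} (hh : BddMeas h) (l : List K) :
    ∫ x, Real.exp (listLogInt ν l h x) ∂(Measure.pi ν) = ∫ x, Real.exp (h x) ∂(Measure.pi ν) := by
  induction l with
  | nil => rfl
  | cons k l ih =>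
    rw [← ih, ← integral_coordInt (hh.listLogInt l).exp k]
    refine integral_congr_ae (Eventually.of_forall fun x => ?_)
    exact exp_coordLogInt (hh.listLogInt l) k x

lemma listLogInt_update (h : (∀ k, Y k) → ℝ) (l : List K) {j : K} (hj : j ∈ l) (x : ∀ k, Y k)
    (y : Y j) : listLogInt ν l h (Function.update x j y) = listLogInt ν l h x := by
  induction l generalizing x y with
  | nil => simp at hj
  | cons k l ih =>
    change Real.log _ = Real.log _
    congr 1
    by_cases hk : k = j
    · subst hk; exact coordInt_update _ _ _ _
    · have hj' : j ∈ l := by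
        rcases List.mem_cons.1 hj with h1 | h1
        · exact absurd h1.symm hk
        · exact h1
      refine coordInt_update_of_invariant k (fun x y => ?_) x y
      change Real.exp (listLogInt ν l h _) = Real.exp (listLogInt ν l h _)
      rw [ih hj']

lemma eq_of_update_invariant {f : (∀ k, Y k) → ℝ}
    (hf : ∀ j x (y : Y j), f (Function.update x j y) = f x) (x x' : ∀ k, Y k) : f x = f x' := by
  suffices h : ∀ s : Finset K, f (fun j => if j ∈ s then x' j else x j) = f x by
    rw [← h Finset.univ]; simp
  intro s
  induction s using Finset.induction with
  | empty => simp
  | insert a s ha ih =>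
    rw [← ih, ← hf a (fun j => if j ∈ s then x' j else x j) (x' a)]
    congr 1
    ext j
    by_cases hj : j = a
    · subst hj; simp
    · simp [hj]

/-- Once every coordinate has been integrated out the function is constant, and the preserved
integral identifies the constant. -/
lemma listLogInt_univ {h : (∀ k, Y k) → ℝ} (hh : BddMeas h) (x : ∀ k, Y k) :
    listLogInt ν Finset.univ.toList h x = Real.log (∫ x, Real.exp (h x) ∂(Measure.pi ν)) := by
  rw [← integral_exp_listLogInt (ν := ν) hh Finset.univ.toList]
  have hc : ∀ z, listLogInt ν Finset.univ.toList h z = listLogInt ν Finset.univ.toList h x :=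
    fun z => eq_of_update_invariant
      (fun j x y => listLogInt_update h _ (Finset.mem_toList.2 (Finset.mem_univ j)) x y) z x
  simp [hc]

/-- This is 1 + (v - w) ≤ exp(v - w) multiplied by exp w; it plays the role of the duality formula
for entropy. -/
lemma exp_mul_le_young (w v : ℝ) :
    Real.exp w * v ≤ Real.exp w * w - Real.exp w + Real.exp v := by
  have h := Real.add_one_le_exp (v - w)
  have h2 : Real.exp v = Real.exp w * Real.exp (v - w) := by rw [← Real.exp_add]; ring_nf
  rw [h2]
  nlinarith [Real.exp_pos w]

/-- The difference telescopes along the list. Each increment g - `coordLogInt ν k g` is a competitor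
in the variational formula for the conditional entropy of exp h in the coordinate k, hence costs at
most that entropy. -/
lemma integral_exp_mul_listLogInt_le {h : (∀ k, Y k) → ℝ} (hh : BddMeas h) (l : List K) :
    ∫ x, Real.exp (h x) * (h x - listLogInt ν l h x) ∂(Measure.pi ν)
      ≤ (l.map fun k => ∫ x, Real.exp (h x) * (h x - coordLogInt ν k h x) ∂(Measure.pi ν)).sum := by
  induction l with
  | nil => simp [listLogInt]
  | cons k l ih =>
    rw [List.map_cons, List.sum_cons]
    set g := listLogInt ν l h with hg
    have hgb : BddMeas g := hh.listLogInt l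
    have hkg : BddMeas (coordLogInt ν k g) := hgb.coordLogInt k
    have hkh : BddMeas (coordLogInt ν k h) := hh.coordLogInt k
    change ∫ x, Real.exp (h x) * (h x - coordLogInt ν k g x) ∂(Measure.pi ν) ≤ _
    have key : ∫ x, Real.exp (h x) * (g x - coordLogInt ν k g x) ∂(Measure.pi ν)
        ≤ ∫ x, Real.exp (h x) * (h x - coordLogInt ν k h x) ∂(Measure.pi ν) := by
      have hv : BddMeas fun x => coordLogInt ν k h x + (g x - coordLogInt ν k g x) :=
        hkh.add (hgb.sub hkg)
      -- The exponential of g - `coordLogInt ν k g` integrates to 1 over the coordinate k, which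
      -- leaves the conditional integral of exp h.
      have e1 : ∫ x, Real.exp (coordLogInt ν k h x + (g x - coordLogInt ν k g x)) ∂(Measure.pi ν)
          = ∫ x, Real.exp (h x) ∂(Measure.pi ν) := by
        rw [← integral_coordInt hv.exp k, ← integral_coordInt hh.exp k]
        refine integral_congr_ae (Eventually.of_forall fun x => ?_)
        have : (fun x => Real.exp (coordLogInt ν k h x + (g x - coordLogInt ν k g x)))
            = fun x => Real.exp (coordLogInt ν k h x - coordLogInt ν k g x) * Real.exp (g x) := by
          ext x; rw [← Real.exp_add]; ring_nf
        simp only [this]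
        rw [coordInt_mul_left k (fun x y => by simp [coordLogInt, coordInt_update]),
          ← exp_coordLogInt hgb k, ← exp_coordLogInt hh k, ← Real.exp_add]
        ring_nf
      have h2 : ∫ x, Real.exp (h x) * (g x - coordLogInt ν k g x) ∂(Measure.pi ν)
          ≤ ∫ x, (Real.exp (h x) * (h x - coordLogInt ν k h x) - Real.exp (h x)
            + Real.exp (coordLogInt ν k h x + (g x - coordLogInt ν k g x))) ∂(Measure.pi ν) := by
        refine integral_mono ((hh.exp.mul (hgb.sub hkg)).integrable _)
          ((((hh.exp.mul (hh.sub hkh)).sub hh.exp).add hv.exp).integrable _) fun x => ?_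
        have := exp_mul_le_young (h x - coordLogInt ν k h x) (g x - coordLogInt ν k g x)
        have e2 : Real.exp (h x) = Real.exp (coordLogInt ν k h x)
            * Real.exp (h x - coordLogInt ν k h x) := by rw [← Real.exp_add]; ring_nf
        simp only [Real.exp_add (coordLogInt ν k h x)]
        rw [e2]
        nlinarith [Real.exp_pos (coordLogInt ν k h x)]
      rw [integral_add (((hh.exp.mul (hh.sub hkh)).sub hh.exp).integrable _) (hv.exp.integrable _),
        integral_sub ((hh.exp.mul (hh.sub hkh)).integrable _) (hh.exp.integrable _), e1] at h2
      linarith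
    have e3 : ∫ x, Real.exp (h x) * (h x - coordLogInt ν k g x) ∂(Measure.pi ν)
        = ∫ x, Real.exp (h x) * (g x - coordLogInt ν k g x) ∂(Measure.pi ν)
          + ∫ x, Real.exp (h x) * (h x - g x) ∂(Measure.pi ν) := by
      rw [← integral_add ((hh.exp.mul (hgb.sub hkg)).integrable _)
        ((hh.exp.mul (hh.sub hgb)).integrable _)]
      congr 1; ext x; ring
    rw [e3]
    exact add_le_add key ih

/-- Tensorization of entropy for `exp h` under a product probability measure. -/
theorem entropy_tensorization {h : (∀ k, Y k) → ℝ} (hh : BddMeas h) :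
    ∫ x, Real.exp (h x) * h x ∂(Measure.pi ν)
        - (∫ x, Real.exp (h x) ∂(Measure.pi ν)) * Real.log (∫ x, Real.exp (h x) ∂(Measure.pi ν))
      ≤ ∑ k, ∫ x, Real.exp (h x) * (h x - coordLogInt ν k h x) ∂(Measure.pi ν) := by
  have := integral_exp_mul_listLogInt_le (ν := ν) hh Finset.univ.toList
  rw [Finset.sum_map_toList] at this
  refine le_trans (le_of_eq ?_) this
  simp only [listLogInt_univ hh, mul_sub]
  rw [integral_sub ((hh.exp.mul hh).integrable _) ((hh.exp.mul (.const _)).integrable _),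
    integral_mul_const]

end Product

/-! ### The entropy bound in one coordinate. -/

/-- For y ≤ 0 the left side is at most y²/2, for y ≥ 0 at most y²eʸ/2; both are monotonicity
statements, with equality at 0. -/
lemma mul_exp_sub_exp_add_one_le {y t : ℝ} (hy : y ≤ t) (ht : 0 ≤ t) :
    Real.exp y * y - Real.exp y + 1 ≤ y ^ 2 * (Real.exp t / 2) := by
  rcases le_total y 0 with h | h
  · have hd : ∀ u : ℝ, HasDerivAt (fun u : ℝ => u ^ 2 / 2 - (Real.exp u * u - Real.exp u + 1))
        (u * (1 - Real.exp u)) u := fun u => by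
      have := ((hasDerivAt_pow 2 u).div_const 2).sub
        ((((Real.hasDerivAt_exp u).mul (hasDerivAt_id u)).sub (Real.hasDerivAt_exp u)).add_const
          (1 : ℝ))
      exact this.congr_deriv (by simp only [id]; push_cast; ring)
    have hanti : Antitone (fun u : ℝ => u ^ 2 / 2 - (Real.exp u * u - Real.exp u + 1)) := by
      refine antitone_of_hasDerivAt_nonpos hd fun u => ?_
      change u * (1 - Real.exp u) ≤ 0
      rcases le_total u 0 with hu | hu
      · exact mul_nonpos_of_nonpos_of_nonneg hu (by linarith [Real.exp_le_one_iff.2 hu])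
      · exact mul_nonpos_of_nonneg_of_nonpos hu (by linarith [Real.one_le_exp hu])
    have := hanti h
    simp at this
    nlinarith [Real.one_le_exp ht, sq_nonneg y]
  · have hd : ∀ u : ℝ, HasDerivAt
        (fun u : ℝ => Real.exp u * (u ^ 2 / 2) - (Real.exp u * u - Real.exp u + 1))
        (Real.exp u * (u ^ 2 / 2)) u := fun u => by
      have := ((Real.hasDerivAt_exp u).mul ((hasDerivAt_pow 2 u).div_const 2)).sub
        ((((Real.hasDerivAt_exp u).mul (hasDerivAt_id u)).sub (Real.hasDerivAt_exp u)).add_const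
          (1 : ℝ))
      exact this.congr_deriv (by simp only [id]; push_cast; ring)
    have hmono : Monotone
        (fun u : ℝ => Real.exp u * (u ^ 2 / 2) - (Real.exp u * u - Real.exp u + 1)) :=
      monotone_of_hasDerivAt_nonneg hd fun u => by
        change 0 ≤ Real.exp u * (u ^ 2 / 2); positivity
    have := hmono h
    simp at this
    nlinarith [Real.exp_le_exp.2 hy, sq_nonneg y]

section OneCoordinate

variable {Y ι : Type*} [MeasurableSpace Y] [Fintype ι] [Nonempty ι]

/-- Entropy bound for the exponential of a finite maximum of centered variables bounded above
by `1`; `p` is a probability vector carried by the maximizers. -/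
lemma entropy_exp_iSup_le (ν : Measure Y) [IsProbabilityMeasure ν] {a : ι → Y → ℝ}
    (ha : ∀ i, BddMeas (a i)) (ha0 : ∀ i, ∫ y, a i y ∂ν = 0) (ha1 : ∀ i y, a i y ≤ 1)
    {A : ι → ℝ} {Z : Y → ℝ} (hZ : ∀ y, Z y = ⨆ i, (A i + a i y))
    {p : ι → Y → ℝ} (hp : ∀ i, BddMeas (p i)) (hp0 : ∀ i y, 0 ≤ p i y)
    (hp1 : ∀ y, ∑ i, p i y = 1) (hpZ : ∀ i y, p i y * (A i + a i y) = p i y * Z y)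
    {t : ℝ} (ht : 0 ≤ t) :
    (1 + t) * ∫ y, Real.exp (t * Z y) * (t * Z y - Real.log (∫ y, Real.exp (t * Z y) ∂ν)) ∂ν
      ≤ t ^ 2 * (Real.exp t / 2) * ∫ y, Real.exp (t * Z y) * ∑ i, p i y * ∫ z, a i z ^ 2 ∂ν ∂ν
        + t ^ 2 * ∫ y, Real.exp (t * Z y) * ∑ i, p i y * a i y ∂ν := by
  have hZb : BddMeas Z := by
    rw [show Z = fun y => ⨆ i, (A i + a i y) from funext hZ]
    exact BddMeas.iSup fun i => (BddMeas.const _).add (ha i)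
  have hle : ∀ i y, A i + a i y ≤ Z y := fun i y => by
    rw [hZ]; exact le_ciSup (f := fun i => A i + a i y) (Set.finite_range _).bddAbove i
  have hf : BddMeas fun y => Real.exp (t * Z y) := (hZb.const_mul t).exp
  have hea : ∀ i, BddMeas fun y => Real.exp (t * a i y) := fun i => ((ha i).const_mul t).exp
  set m := ∫ y, Real.exp (t * Z y) ∂ν with hm
  set lm := Real.log m with hlm
  have hone : ∀ i, 1 ≤ ∫ y, Real.exp (t * a i y) ∂ν := fun i => by
    have h1 : ∫ y, (t * a i y + 1) ∂ν = 1 := by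
      rw [integral_add (((ha i).const_mul t).integrable _) (integrable_const _),
        integral_const_mul, ha0]; simp
    rw [← h1]
    exact integral_mono ((((ha i).const_mul t).add (.const 1)).integrable _)
      ((hea i).integrable _) fun y => Real.add_one_le_exp _
  have hAm : ∀ i, Real.exp (t * A i) ≤ m := fun i => by
    calc Real.exp (t * A i) ≤ Real.exp (t * A i) * ∫ y, Real.exp (t * a i y) ∂ν :=
          le_mul_of_one_le_right (Real.exp_pos _).le (hone i)
      _ = ∫ y, Real.exp (t * A i) * Real.exp (t * a i y) ∂ν := (integral_const_mul _ _).symm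
      _ ≤ m := by
        refine integral_mono (((hea i).const_mul _).integrable _) (hf.integrable _) fun y => ?_
        change Real.exp (t * A i) * Real.exp (t * a i y) ≤ Real.exp (t * Z y)
        rw [← Real.exp_add, ← mul_add]
        exact Real.exp_le_exp.2 (mul_le_mul_of_nonneg_left (hle i y) ht)
  have i0 : ι := Classical.arbitrary ι
  have hmpos : 0 < m := (Real.exp_pos _).trans_le (hAm i0)
  have hAlm : ∀ i, t * A i ≤ lm := fun i => (Real.le_log_iff_exp_le hmpos).2 (hAm i)
  have hexplm : Real.exp lm = m := Real.exp_log hmpos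
  have hlogle : ∀ y, t * Z y - lm ≤ t := fun y => by
    obtain ⟨i, hi⟩ := exists_eq_ciSup_of_finite (f := fun i => A i + a i y)
    rw [hZ, ← hi]
    nlinarith [hAlm i, mul_le_mul_of_nonneg_left (ha1 i y) ht]
  have hfp : ∀ i, BddMeas fun y => Real.exp (t * Z y) * p i y := fun i => hf.mul (hp i)
  -- `q i` is the mean weight of the index i under the law with density exp(tZ)/m; these are the
  -- coefficients of the mixture.
  let w : ι → ℝ := fun i => ∫ y, Real.exp (t * Z y) * p i y ∂ν
  let q : ι → ℝ := fun i => w i / m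
  have hw0 : ∀ i, 0 ≤ w i := fun i =>
    integral_nonneg fun y => mul_nonneg (Real.exp_pos _).le (hp0 i y)
  have hq0 : ∀ i, 0 ≤ q i := fun i => div_nonneg (hw0 i) hmpos.le
  have hqm : ∀ i, q i * m = w i := fun i => div_mul_cancel₀ _ hmpos.ne'
  have hwsum : ∑ i, w i = m := by
    rw [← integral_finsetSum _ fun i _ => (hfp i).integrable _]
    congr 1; ext y; rw [← Finset.mul_sum, hp1, mul_one]
  have hqsum : ∑ i, q i = 1 := by
    rw [← Finset.sum_div, hwsum, div_self hmpos.ne']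
  let u : Y → ℝ := fun y => t * Z y - lm
  have hu : BddMeas u := (hZb.const_mul t).sub (.const lm)
  have heu : ∫ y, Real.exp (u y) ∂ν = 1 := by
    have : (fun y => Real.exp (u y)) = fun y => Real.exp (t * Z y) * m⁻¹ := by
      ext y; simp only [u]; rw [Real.exp_sub, hexplm, div_eq_mul_inv]
    rw [this, integral_mul_const, ← hm, mul_inv_cancel₀ hmpos.ne']
  set I := ∫ y, Real.exp (t * Z y) * u y ∂ν with hI
  -- the bound for each term of the mixture
  have hyoung : ∀ i, ∫ y, Real.exp (t * a i y) * u y ∂ν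
      ≤ t ^ 2 * (Real.exp t / 2) * ∫ z, a i z ^ 2 ∂ν := fun i => by
    have hta := (ha i).const_mul t
    have hr : BddMeas fun y => Real.exp (t * a i y) * (t * a i y) - Real.exp (t * a i y) :=
      ((hea i).mul hta).sub (hea i)
    have hsq : BddMeas fun y => a i y ^ 2 := by simpa only [pow_two] using (ha i).mul (ha i)
    have h1 : ∫ y, Real.exp (t * a i y) * u y ∂ν
        ≤ ∫ y, (Real.exp (t * a i y) * (t * a i y) - Real.exp (t * a i y) + Real.exp (u y)) ∂ν :=
      integral_mono (((hea i).mul hu).integrable _) ((hr.add hu.exp).integrable _)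
        fun y => exp_mul_le_young _ _
    have h2 : ∫ y, (Real.exp (t * a i y) * (t * a i y) - Real.exp (t * a i y) + 1) ∂ν
        ≤ ∫ y, t ^ 2 * (Real.exp t / 2) * a i y ^ 2 ∂ν := by
      refine integral_mono ((hr.add (.const 1)).integrable _) ((hsq.const_mul _).integrable _)
        fun y => ?_
      have := mul_exp_sub_exp_add_one_le (y := t * a i y) (t := t)
        (by nlinarith [mul_le_mul_of_nonneg_left (ha1 i y) ht]) ht
      refine this.trans (le_of_eq ?_); ring
    rw [integral_add (hr.integrable _) (hu.exp.integrable _), heu] at h1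
    rw [integral_add (hr.integrable _) (integrable_const _), integral_const_mul] at h2
    simp only [integral_const, probReal_univ, smul_eq_mul, one_mul] at h2
    linarith
  -- With G the mixture of the exponentials exp(t(A i + a i)) with weights `q i`, write exp(tZ) = G
  -- + (exp(tZ) - G); the second part is nonnegative, and there u ≤ t.
  have hsplit : I ≤ (∑ i, q i * Real.exp (t * A i) * ∫ y, Real.exp (t * a i y) * u y ∂ν)
      + t * (m - ∑ i, q i * Real.exp (t * A i) * ∫ y, Real.exp (t * a i y) ∂ν) := by
    have hG1 : BddMeas fun y => ∑ i, q i * Real.exp (t * A i) * (Real.exp (t * a i y) * u y) :=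
      BddMeas.sum _ fun i => ((hea i).mul hu).const_mul _
    have hG2 : BddMeas fun y => ∑ i, q i * Real.exp (t * A i) * Real.exp (t * a i y) :=
      BddMeas.sum _ fun i => (hea i).const_mul _
    have : I ≤ ∫ y, ((∑ i, q i * Real.exp (t * A i) * (Real.exp (t * a i y) * u y))
        + t * (Real.exp (t * Z y) - ∑ i, q i * Real.exp (t * A i) * Real.exp (t * a i y))) ∂ν := by
      refine integral_mono ((hf.mul hu).integrable _)
        ((hG1.add ((hf.sub hG2).const_mul t)).integrable _) fun y => ?_
      have hGf : ∑ i, q i * Real.exp (t * A i) * Real.exp (t * a i y) ≤ Real.exp (t * Z y) := by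
        calc ∑ i, q i * Real.exp (t * A i) * Real.exp (t * a i y)
            ≤ ∑ i, q i * Real.exp (t * Z y) := by
              refine Finset.sum_le_sum fun i _ => ?_
              rw [mul_assoc, ← Real.exp_add, ← mul_add]
              exact mul_le_mul_of_nonneg_left (Real.exp_le_exp.2
                (mul_le_mul_of_nonneg_left (hle i y) ht)) (hq0 i)
          _ = Real.exp (t * Z y) := by rw [← Finset.sum_mul, hqsum, one_mul]
      have e : ∑ i, q i * Real.exp (t * A i) * (Real.exp (t * a i y) * u y)
          = (∑ i, q i * Real.exp (t * A i) * Real.exp (t * a i y)) * u y := by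
        rw [Finset.sum_mul]; exact Finset.sum_congr rfl fun i _ => by ring
      change Real.exp (t * Z y) * u y ≤ _
      simp only [e]
      nlinarith [mul_le_mul_of_nonneg_left (hlogle y) (sub_nonneg.2 hGf)]
    rw [integral_add (hG1.integrable _) (((hf.sub hG2).const_mul t).integrable _),
      integral_const_mul, integral_sub (hf.integrable _) (hG2.integrable _),
      integral_finsetSum _ fun i _ => (((hea i).mul hu).const_mul _).integrable _,
      integral_finsetSum _ fun i _ => ((hea i).const_mul _).integrable _] at this
    simpa only [integral_const_mul] using this
  have hb1 : ∑ i, q i * Real.exp (t * A i) * ∫ y, Real.exp (t * a i y) * u y ∂ν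
      ≤ t ^ 2 * (Real.exp t / 2) * ∑ i, w i * ∫ z, a i z ^ 2 ∂ν := by
    rw [Finset.mul_sum]
    refine Finset.sum_le_sum fun i _ => ?_
    have hv : 0 ≤ t ^ 2 * (Real.exp t / 2) * ∫ z, a i z ^ 2 ∂ν :=
      mul_nonneg (by positivity) (integral_nonneg fun z => sq_nonneg _)
    calc q i * Real.exp (t * A i) * ∫ y, Real.exp (t * a i y) * u y ∂ν
        ≤ q i * Real.exp (t * A i) * (t ^ 2 * (Real.exp t / 2) * ∫ z, a i z ^ 2 ∂ν) :=
          mul_le_mul_of_nonneg_left (hyoung i) (mul_nonneg (hq0 i) (Real.exp_pos _).le)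
      _ ≤ q i * m * (t ^ 2 * (Real.exp t / 2) * ∫ z, a i z ^ 2 ∂ν) :=
          mul_le_mul_of_nonneg_right (mul_le_mul_of_nonneg_left (hAm i) (hq0 i)) hv
      _ = _ := by rw [hqm]; ring
  -- Centering gives ∫ exp(t a i) ≥ 1, and 1 + y ≤ eʸ at y = t A i - lm bounds m - exp(t A i) by m
  -- (lm - t A i).
  have hb2 : m - ∑ i, q i * Real.exp (t * A i) * ∫ y, Real.exp (t * a i y) ∂ν
      ≤ ∑ i, w i * (lm - t * A i) := by
    calc m - ∑ i, q i * Real.exp (t * A i) * ∫ y, Real.exp (t * a i y) ∂ν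
        = ∑ i, q i * (m - Real.exp (t * A i) * ∫ y, Real.exp (t * a i y) ∂ν) := by
          simp only [mul_sub, Finset.sum_sub_distrib, ← Finset.sum_mul, hqsum, mul_assoc, one_mul]
      _ ≤ _ := by
          refine Finset.sum_le_sum fun i _ => ?_
          rw [← hqm, mul_assoc]
          refine mul_le_mul_of_nonneg_left ?_ (hq0 i)
          have h1 := Real.add_one_le_exp (t * A i - lm)
          rw [Real.exp_sub, hexplm, le_div_iff₀ hmpos] at h1
          nlinarith [le_mul_of_one_le_right (Real.exp_pos (t * A i)).le (hone i)]
  -- On the support of `p i` one has A i = Z - a i. The term -I that appears, multiplied by t and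
  -- moved to the left, creates the factor 1 + t.
  have hb3 : ∑ i, w i * (lm - t * A i)
      = t * (∫ y, Real.exp (t * Z y) * ∑ i, p i y * a i y ∂ν) - I := by
    have hpa : BddMeas fun y => Real.exp (t * Z y) * ∑ i, p i y * a i y :=
      hf.mul (BddMeas.sum _ fun i => (hp i).mul (ha i))
    rw [← integral_const_mul, hI, ← integral_sub ((hpa.const_mul t).integrable _)
      ((hf.mul hu).integrable _)]
    simp only [w, ← integral_mul_const]
    rw [← integral_finsetSum _ fun i _ => ((hfp i).mul (.const _)).integrable _]
    congr 1; ext y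
    have e1 : t * Z y - lm = ∑ i, (p i y * (t * (A i + a i y)) - p i y * lm) := by
      rw [Finset.sum_sub_distrib, ← Finset.sum_mul, hp1, one_mul]
      congr 1
      simp only [mul_left_comm (p _ y) t, hpZ]
      rw [← Finset.mul_sum, ← Finset.sum_mul, hp1, one_mul]
    simp only [u, e1, Finset.mul_sum]
    rw [← Finset.sum_sub_distrib]
    exact Finset.sum_congr rfl fun i _ => by ring
  have hfv : ∫ y, Real.exp (t * Z y) * ∑ i, p i y * ∫ z, a i z ^ 2 ∂ν ∂ν
      = ∑ i, w i * ∫ z, a i z ^ 2 ∂ν := by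
    simp only [w, ← integral_mul_const]
    rw [← integral_finsetSum _ fun i _ => ((hfp i).mul (.const _)).integrable _]
    congr 1; ext y
    rw [Finset.mul_sum]
    exact Finset.sum_congr rfl fun i _ => by rw [mul_assoc]
  rw [hfv]
  have hb4 := mul_le_mul_of_nonneg_left hb2 ht
  rw [hb3] at hb4
  change (1 + t) * I ≤ _
  nlinarith [hsplit, hb1, hb4]

end OneCoordinate

/-! ### The entropy inequality for the maximum of independent sums. -/

section Maximum

variable {K ι : Type*} [Fintype K] [DecidableEq K] [Fintype ι] [Nonempty ι]
  {Y : K → Type*} [∀ k, MeasurableSpace (Y k)]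
  {ν : ∀ k, Measure (Y k)} [∀ k, IsProbabilityMeasure (ν k)]

/-- The maximum over a finite family `a` of the sums `∑ₖ a i k (x k)`. -/
noncomputable def maxSum (a : ι → ∀ k, Y k → ℝ) (x : ∀ k, Y k) : ℝ := ⨆ i, ∑ k, a i k (x k)

lemma le_maxSum (a : ι → ∀ k, Y k → ℝ) (i : ι) (x : ∀ k, Y k) :
    ∑ k, a i k (x k) ≤ maxSum a x :=
  le_ciSup (f := fun i => ∑ k, a i k (x k)) (Set.finite_range _).bddAbove i

lemma exists_eq_maxSum (a : ι → ∀ k, Y k → ℝ) (x : ∀ k, Y k) :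
    ∃ i, ∑ k, a i k (x k) = maxSum a x :=
  exists_eq_ciSup_of_finite (f := fun i => ∑ k, a i k (x k))

lemma BddMeas.coordSum {a : ι → ∀ k, Y k → ℝ} (ha : ∀ i k, BddMeas (a i k)) (i : ι) :
    BddMeas (fun x : ∀ k, Y k => ∑ k, a i k (x k)) :=
  BddMeas.sum _ fun k => (ha i k).comp (measurable_pi_apply k)

lemma BddMeas.maxSum {a : ι → ∀ k, Y k → ℝ} (ha : ∀ i k, BddMeas (a i k)) :
    BddMeas (maxSum a) :=
  BddMeas.iSup fun i => BddMeas.coordSum ha i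

open Classical in
/-- The uniform weights on the set of indices attaining the maximum. -/
noncomputable def argmaxWeight (a : ι → ∀ k, Y k → ℝ) (i : ι) (x : ∀ k, Y k) : ℝ :=
  (if ∑ k, a i k (x k) = maxSum a x then 1 else 0)
    / ∑ j, (if ∑ k, a j k (x k) = maxSum a x then 1 else 0)

lemma argmaxWeight_denom_pos (a : ι → ∀ k, Y k → ℝ) (x : ∀ k, Y k) :
    0 < ∑ j, (open Classical in (if ∑ k, a j k (x k) = maxSum a x then (1 : ℝ) else 0)) := by
  classical
  obtain ⟨i, hi⟩ := exists_eq_maxSum a x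
  refine Finset.sum_pos' (fun j _ => by split_ifs <;> norm_num) ⟨i, Finset.mem_univ i, ?_⟩
  simp [hi]

lemma argmaxWeight_nonneg (a : ι → ∀ k, Y k → ℝ) (i : ι) (x : ∀ k, Y k) :
    0 ≤ argmaxWeight a i x := by
  unfold argmaxWeight
  refine div_nonneg ?_ (argmaxWeight_denom_pos a x).le
  split_ifs <;> norm_num

lemma sum_argmaxWeight (a : ι → ∀ k, Y k → ℝ) (x : ∀ k, Y k) :
    ∑ i, argmaxWeight a i x = 1 := by
  unfold argmaxWeight
  rw [← Finset.sum_div, div_self (argmaxWeight_denom_pos a x).ne']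

lemma argmaxWeight_mul (a : ι → ∀ k, Y k → ℝ) (i : ι) (x : ∀ k, Y k) :
    argmaxWeight a i x * ∑ k, a i k (x k) = argmaxWeight a i x * maxSum a x := by
  by_cases h : ∑ k, a i k (x k) = maxSum a x
  · rw [h]
  · simp [argmaxWeight, h]

lemma BddMeas.argmaxWeight {a : ι → ∀ k, Y k → ℝ} (ha : ∀ i k, BddMeas (a i k)) (i : ι) :
    BddMeas (argmaxWeight a i) := by
  classical
  have hm : ∀ j, Measurable fun x : ∀ k, Y k =>
      if ∑ k, a j k (x k) = MTL.maxSum a x then (1 : ℝ) else 0 := fun j =>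
    Measurable.ite (measurableSet_eq_fun (BddMeas.coordSum ha j).meas (BddMeas.maxSum ha).meas)
      measurable_const measurable_const
  refine ⟨?_, 1, fun x => ?_⟩
  · unfold MTL.argmaxWeight
    exact (hm i).div (Finset.measurable_fun_sum Finset.univ fun j _ => hm j)
  · rw [abs_of_nonneg (argmaxWeight_nonneg a i x), ← sum_argmaxWeight a x]
    exact Finset.single_le_sum (fun j _ => argmaxWeight_nonneg a j x) (Finset.mem_univ i)

/-- The entropy inequality for the exponential of the maximum of independent centered sums. -/
lemma entropy_exp_maxSum_le {a : ι → ∀ k, Y k → ℝ} (ha : ∀ i k, BddMeas (a i k))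
    (ha0 : ∀ i k, ∫ y, a i k y ∂(ν k) = 0) (ha1 : ∀ i k y, a i k y ≤ 1)
    {σ2 : ℝ} (hσ : ∀ i, ∑ k, ∫ y, a i k y ^ 2 ∂(ν k) ≤ σ2) {t : ℝ} (ht : 0 ≤ t) :
    (1 + t) * (∫ x, Real.exp (t * maxSum a x) * (t * maxSum a x) ∂(Measure.pi ν)
        - (∫ x, Real.exp (t * maxSum a x) ∂(Measure.pi ν))
          * Real.log (∫ x, Real.exp (t * maxSum a x) ∂(Measure.pi ν)))
      ≤ t ^ 2 * (Real.exp t / 2) * (σ2 * ∫ x, Real.exp (t * maxSum a x) ∂(Measure.pi ν))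
        + t ^ 2 * ∫ x, Real.exp (t * maxSum a x) * maxSum a x ∂(Measure.pi ν) := by
  have hZ := BddMeas.maxSum ha
  have htZ := hZ.const_mul t
  have hp := fun i => BddMeas.argmaxWeight ha i
  let V : K → (∀ k, Y k) → ℝ := fun k x => Real.exp (t * maxSum a x) *
    ∑ i, argmaxWeight a i x * ∫ y, a i k y ^ 2 ∂(ν k)
  let W : K → (∀ k, Y k) → ℝ := fun k x => Real.exp (t * maxSum a x) *
    ∑ i, argmaxWeight a i x * a i k (x k)
  have hV : ∀ k, BddMeas (V k) := fun k =>
    htZ.exp.mul (BddMeas.sum _ fun i => (hp i).mul (.const _))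
  have hW : ∀ k, BddMeas (W k) := fun k =>
    htZ.exp.mul (BddMeas.sum _ fun i => (hp i).mul ((ha i k).comp (measurable_pi_apply k)))
  have hcoord : ∀ k, (1 + t) * ∫ x, Real.exp (t * maxSum a x) *
        (t * maxSum a x - coordLogInt ν k (fun x => t * maxSum a x) x) ∂(Measure.pi ν)
      ≤ t ^ 2 * (Real.exp t / 2) * ∫ x, V k x ∂(Measure.pi ν)
        + t ^ 2 * ∫ x, W k x ∂(Measure.pi ν) := by
    intro k
    have hU : BddMeas fun x => Real.exp (t * maxSum a x) *
        (t * maxSum a x - coordLogInt ν k (fun x => t * maxSum a x) x) :=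
      htZ.exp.mul (htZ.sub (htZ.coordLogInt k))
    rw [← integral_coordInt hU k, ← integral_coordInt (hV k) k, ← integral_coordInt (hW k) k,
      ← integral_const_mul, ← integral_const_mul, ← integral_const_mul,
      ← integral_add (((hV k).coordInt k).const_mul _ |>.integrable _)
        (((hW k).coordInt k).const_mul _ |>.integrable _)]
    refine integral_mono ((hU.coordInt k).const_mul _ |>.integrable _)
      ((((hV k).coordInt k).const_mul _).add (((hW k).coordInt k).const_mul _) |>.integrable _)
      fun x => ?_
    have hup : Measurable fun y : Y k => Function.update x k y := measurable_update x
    have hsum : ∀ i y, ∑ j, a i j (Function.update x k y j)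
        = (∑ j ∈ Finset.univ.erase k, a i j (x j)) + a i k y := fun i y => by
      rw [← Finset.sum_erase_add _ _ (Finset.mem_univ k), Function.update_self]
      congr 1
      refine Finset.sum_congr rfl fun j hj => ?_
      rw [Function.update_of_ne (Finset.ne_of_mem_erase hj)]
    have := entropy_exp_iSup_le (ν k) (a := fun i => a i k) (fun i => ha i k)
      (fun i => ha0 i k) (fun i => ha1 i k)
      (A := fun i => ∑ j ∈ Finset.univ.erase k, a i j (x j))
      (Z := fun y => maxSum a (Function.update x k y))
      (fun y => by simp only [maxSum, hsum])
      (p := fun i y => argmaxWeight a i (Function.update x k y))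
      (fun i => (hp i).comp hup) (fun i y => argmaxWeight_nonneg a i _)
      (fun y => sum_argmaxWeight a _)
      (fun i y => by rw [← hsum]; exact argmaxWeight_mul a i _) ht
    simpa [coordInt, coordLogInt, V, W] using this
  have htens := entropy_tensorization (ν := ν) htZ
  have hsumV : ∑ k, ∫ x, V k x ∂(Measure.pi ν)
      ≤ σ2 * ∫ x, Real.exp (t * maxSum a x) ∂(Measure.pi ν) := by
    rw [← integral_finsetSum _ fun k _ => (hV k).integrable _, ← integral_const_mul]
    refine integral_mono ((BddMeas.sum _ hV).integrable _) ((htZ.exp.const_mul _).integrable _)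
      fun x => ?_
    simp only [V]
    rw [← Finset.mul_sum, Finset.sum_comm, mul_comm]
    refine mul_le_mul_of_nonneg_right ?_ (Real.exp_pos _).le
    calc ∑ i, ∑ k, argmaxWeight a i x * ∫ y, a i k y ^ 2 ∂(ν k)
        ≤ ∑ i, argmaxWeight a i x * σ2 := Finset.sum_le_sum fun i _ => by
          rw [← Finset.mul_sum]
          exact mul_le_mul_of_nonneg_left (hσ i) (argmaxWeight_nonneg a i x)
      _ = σ2 := by rw [← Finset.sum_mul, sum_argmaxWeight, one_mul]
  -- The coordinates of a maximizing sum add up to the maximum itself, so no variance of Z enters.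
  have hsumW : ∑ k, ∫ x, W k x ∂(Measure.pi ν)
      = ∫ x, Real.exp (t * maxSum a x) * maxSum a x ∂(Measure.pi ν) := by
    rw [← integral_finsetSum _ fun k _ => (hW k).integrable _]
    congr 1; ext x
    simp only [W]
    rw [← Finset.mul_sum, Finset.sum_comm]
    simp only [← Finset.mul_sum, argmaxWeight_mul]
    rw [← Finset.sum_mul, sum_argmaxWeight, one_mul]
  calc _ ≤ (1 + t) * ∑ k, ∫ x, Real.exp (t * maxSum a x) *
        (t * maxSum a x - coordLogInt ν k (fun x => t * maxSum a x) x) ∂(Measure.pi ν) :=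
        mul_le_mul_of_nonneg_left htens (by linarith)
    _ ≤ ∑ k, (t ^ 2 * (Real.exp t / 2) * ∫ x, V k x ∂(Measure.pi ν)
        + t ^ 2 * ∫ x, W k x ∂(Measure.pi ν)) := by
        rw [Finset.mul_sum]; exact Finset.sum_le_sum fun k _ => hcoord k
    _ = t ^ 2 * (Real.exp t / 2) * ∑ k, ∫ x, V k x ∂(Measure.pi ν)
        + t ^ 2 * ∑ k, ∫ x, W k x ∂(Measure.pi ν) := by
        rw [Finset.sum_add_distrib, ← Finset.mul_sum, ← Finset.mul_sum]
    _ ≤ _ := by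
        rw [hsumW]
        have : 0 ≤ t ^ 2 * (Real.exp t / 2) := by positivity
        linarith [mul_le_mul_of_nonneg_left hsumV this]

end Maximum

/-! ### From entropy to exponential moments, and the choice of the Chernoff exponent. -/

lemma BddMeas.integrableExpSet_eq_univ {Ω : Type*} [MeasurableSpace Ω] {P : Measure Ω}
    [IsFiniteMeasure P] {Z : Ω → ℝ} (hZ : BddMeas Z) : integrableExpSet Z P = Set.univ :=
  Set.eq_univ_of_forall fun t => ((hZ.const_mul t).exp).integrable P

/-- Integration of the differential inequality `t L' - (1 + t) L ≤ t² eᵗ σ² / 2` for the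
cumulant generating function `L`. -/
lemma cgf_le_of_entropy_le {Ω : Type*} [MeasurableSpace Ω] {P : Measure Ω}
    [IsProbabilityMeasure P] {Z : Ω → ℝ} (hZ : BddMeas Z) {σ2 : ℝ}
    (h : ∀ t, 0 < t → (1 + t) * (∫ x, Real.exp (t * Z x) * (t * Z x) ∂P
        - (∫ x, Real.exp (t * Z x) ∂P) * Real.log (∫ x, Real.exp (t * Z x) ∂P))
      ≤ t ^ 2 * (Real.exp t / 2) * (σ2 * ∫ x, Real.exp (t * Z x) ∂P)
        + t ^ 2 * ∫ x, Real.exp (t * Z x) * Z x ∂P) {t : ℝ} (ht : 0 < t) :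
    cgf Z P t ≤ t * Real.exp t * (∫ x, Z x ∂P + σ2 * t / 2) := by
  have hint : ∀ s, s ∈ interior (integrableExpSet Z P) := fun s => by
    simp [hZ.integrableExpSet_eq_univ]
  let L' : ℝ → ℝ := fun s => (∫ x, Z x * Real.exp (s * Z x) ∂P) / mgf Z P s
  have hL : ∀ s, HasDerivAt (cgf Z P) (L' s) s := fun s => by
    have := (analyticAt_cgf (hint s)).differentiableAt.hasDerivAt
    rwa [deriv_cgf (hint s)] at this
  have hineq : ∀ s, 0 < s → s * L' s - (1 + s) * cgf Z P s ≤ s ^ 2 * (Real.exp s / 2) * σ2 := by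
    intro s hs
    have hmpos : 0 < mgf Z P s := mgf_pos (((hZ.const_mul s).exp).integrable P)
    have h1 := h s hs
    have e1 : ∫ x, Real.exp (s * Z x) * (s * Z x) ∂P = s * (L' s * mgf Z P s) := by
      simp only [L']
      rw [div_mul_cancel₀ _ hmpos.ne', ← integral_const_mul]
      congr 1; ext x; ring
    have e2 : ∫ x, Real.exp (s * Z x) * Z x ∂P = L' s * mgf Z P s := by
      simp only [L']
      rw [div_mul_cancel₀ _ hmpos.ne']
      congr 1; ext x; ring
    have e3 : ∫ x, Real.exp (s * Z x) ∂P = mgf Z P s := rfl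
    rw [e1, e2, e3, show Real.log (mgf Z P s) = cgf Z P s from rfl] at h1
    refine le_of_mul_le_mul_right ?_ hmpos
    nlinarith [h1]
  -- The integrating factor of s L' - (1 + s) L is e⁻ˢ/s²: it produces the derivative of e⁻ˢ L(s)/s.
  let φ : ℝ → ℝ := fun s => Real.exp (-s) * (cgf Z P s / s) - σ2 / 2 * s
  have hφ : ∀ s, 0 < s → HasDerivAt φ (Real.exp (-s) * (-1) * (cgf Z P s / s)
      + Real.exp (-s) * ((L' s * s - cgf Z P s * 1) / s ^ 2) - σ2 / 2 * 1) s := fun s hs =>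
    (((hasDerivAt_neg s).exp.mul ((hL s).div (hasDerivAt_id s) hs.ne')).sub
      ((hasDerivAt_id s).const_mul (σ2 / 2)))
  have hanti : AntitoneOn φ (Set.Ioi 0) := by
    refine antitoneOn_of_deriv_nonpos (convex_Ioi 0)
      (fun s hs => (hφ s hs).continuousAt.continuousWithinAt)
      (fun s hs => (hφ s (interior_subset hs)).differentiableAt.differentiableWithinAt)
      fun s hs => ?_
    have hs0 : 0 < s := interior_subset hs
    rw [(hφ s hs0).deriv]
    have h1 := hineq s hs0
    have e : Real.exp (-s) * (-1) * (cgf Z P s / s)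
      + Real.exp (-s) * ((L' s * s - cgf Z P s * 1) / s ^ 2)
      = Real.exp (-s) / s ^ 2 * (s * L' s - (1 + s) * cgf Z P s) := by field_simp; ring
    have h2 := mul_le_mul_of_nonneg_left h1
      (show 0 ≤ Real.exp (-s) / s ^ 2 by positivity)
    have e2 : Real.exp (-s) / s ^ 2 * (s ^ 2 * (Real.exp s / 2) * σ2) = σ2 / 2 := by
      rw [Real.exp_neg]; field_simp
    rw [e]; linarith
  -- Since L(0) = 0, the quotient L(s)/s tends to L'(0), the mean of Z.
  have hlim : Tendsto φ (𝓝[>] 0) (𝓝 (∫ x, Z x ∂P)) := by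
    have h0 : Tendsto (fun s => cgf Z P s / s) (𝓝[>] 0) (𝓝 (∫ x, Z x ∂P)) := by
      have := (hL 0).tendsto_slope_zero_right
      have e : L' 0 = ∫ x, Z x ∂P := by simp [L']
      rw [e] at this
      refine this.congr fun s => ?_
      simp [div_eq_inv_mul]
    have h1 : Tendsto (fun s : ℝ => Real.exp (-s)) (𝓝[>] 0) (𝓝 1) := by
      have : Continuous fun s : ℝ => Real.exp (-s) := by fun_prop
      simpa using (this.tendsto 0).mono_left nhdsWithin_le_nhds
    have h2 : Tendsto (fun s : ℝ => σ2 / 2 * s) (𝓝[>] 0) (𝓝 0) := by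
      have : Continuous fun s : ℝ => σ2 / 2 * s := by fun_prop
      simpa using (this.tendsto 0).mono_left nhdsWithin_le_nhds
    simpa using (h1.mul h0).sub h2
  have hle : φ t ≤ ∫ x, Z x ∂P := by
    refine ge_of_tendsto hlim ?_
    filter_upwards [Ioo_mem_nhdsGT ht] with s hs
    exact hanti hs.1 ht hs.2.le
  have hfin : Real.exp (-t) * (cgf Z P t / t) ≤ ∫ x, Z x ∂P + σ2 * t / 2 := by
    simp only [φ] at hle; linarith
  have h3 := mul_le_mul_of_nonneg_left hfin (show 0 ≤ t * Real.exp t by positivity)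
  have e3 : t * Real.exp t * (Real.exp (-t) * (cgf Z P t / t)) = cgf Z P t := by
    rw [Real.exp_neg]; field_simp
  rwa [e3] at h3

/-- A Padé bound for the exponential, suited to the substitution t = s/(1 + s/2), under which (1 +
t/2)/(1 - t/2) = 1 + s. -/
lemma one_sub_half_mul_exp_le {t : ℝ} (ht : 0 ≤ t) :
    (1 - t / 2) * Real.exp t ≤ 1 + t / 2 := by
  have hd : ∀ u : ℝ, HasDerivAt (fun u : ℝ => 1 + u / 2 - (1 - u / 2) * Real.exp u)
      ((1 - (1 - u) * Real.exp u) / 2) u := fun u => by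
    have := (((hasDerivAt_id u).div_const 2).const_add 1).sub
      ((((hasDerivAt_id u).div_const 2).const_sub 1).mul (Real.hasDerivAt_exp u))
    exact this.congr_deriv (by simp only [id]; ring)
  have hmono : Monotone (fun u : ℝ => 1 + u / 2 - (1 - u / 2) * Real.exp u) :=
    monotone_of_hasDerivAt_nonneg hd fun u => by
      change 0 ≤ (1 - (1 - u) * Real.exp u) / 2
      have h1 := Real.add_one_le_exp (-u)
      have h2 : Real.exp (-u) * Real.exp u = 1 := by rw [← Real.exp_add]; simp
      nlinarith [mul_le_mul_of_nonneg_right h1 (Real.exp_pos u).le]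
  have := hmono ht
  simp at this
  linarith

/-- Choice of the exponent in the Chernoff bound. -/
lemma exists_chernoff_exponent {E σ2 x : ℝ} (hE : 0 ≤ E) (hσ : 0 ≤ σ2) (hx : 0 < x) :
    ∃ t, 0 < t ∧ x + t * Real.exp t * (E + σ2 * t / 2)
      ≤ t * (E + x / 2 + 2 * Real.sqrt (x * (E + σ2))) := by
  rcases (add_nonneg hE hσ).eq_or_lt with h | h
  · have h1 : E = 0 := by linarith
    have h2 : σ2 = 0 := by linarith
    -- With E = σ² = 0 the requirement is x ≤ t x/2.
    refine ⟨2, two_pos, ?_⟩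
    simp [h1, h2]
    linarith
  · set D := E + σ2 with hD
    set s := Real.sqrt (x / D) with hs
    have hs0 : 0 < s := Real.sqrt_pos.2 (div_pos hx h)
    have hs2 : s ^ 2 * D = x := by
      rw [hs, Real.sq_sqrt (div_pos hx h).le, div_mul_cancel₀ _ h.ne']
    have hsD : Real.sqrt (x * D) = s * D := by
      rw [← hs2, show s ^ 2 * D * D = (s * D) ^ 2 by ring, Real.sqrt_sq (by positivity)]
    -- This value makes x = t (x/2 + s D) exact, and s D is √(x D); the remaining slack s D absorbs
    -- the growth of exp t.
    set t := s / (1 + s / 2) with ht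
    have hden : 0 < 1 + s / 2 := by positivity
    have ht0 : 0 < t := div_pos hs0 hden
    have hts : t * (1 + s / 2) = s := div_mul_cancel₀ _ hden.ne'
    have hexp : Real.exp t ≤ 1 + s := by
      have h1 := one_sub_half_mul_exp_le ht0.le
      have h2 : (1 - t / 2) * (1 + s / 2) = 1 := by linarith
      have h3 := mul_le_mul_of_nonneg_right h1 hden.le
      nlinarith
    have hexp2 : Real.exp t * (t / 2) ≤ s := by
      have h1 : Real.exp t * (t / 2) ≤ (1 + s) * (t / 2) :=
        mul_le_mul_of_nonneg_right hexp (by positivity)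
      nlinarith [mul_pos ht0 hs0]
    refine ⟨t, ht0, ?_⟩
    rw [hsD]
    have h1 : x = t * (x / 2 + s * D) := by
      have : t * (x / 2 + s * D) = t * (1 + s / 2) * (s * D) := by rw [← hs2]; ring
      rw [this, hts, ← hs2]; ring
    have h2 : Real.exp t * (E + σ2 * t / 2) ≤ E + s * D := by
      nlinarith [mul_le_mul_of_nonneg_right hexp hE, mul_le_mul_of_nonneg_right hexp2 hσ]
    nlinarith [mul_le_mul_of_nonneg_left h2 ht0.le]

/-! ### The tail bound for the maximum, and symmetrization with fixed signs. -/

section Maximum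

variable {K ι : Type*} [Fintype K] [DecidableEq K] [Fintype ι] [Nonempty ι]
  {Y : K → Type*} [∀ k, MeasurableSpace (Y k)]
  {ν : ∀ k, Measure (Y k)} [∀ k, IsProbabilityMeasure (ν k)]

/-- Any upper bound E of the mean is admitted, so that twice the Rademacher complexity can be
inserted later. -/
lemma measure_lt_maxSum_le_of_le_one {a : ι → ∀ k, Y k → ℝ} (ha : ∀ i k, BddMeas (a i k))
    (ha0 : ∀ i k, ∫ y, a i k y ∂(ν k) = 0) (ha1 : ∀ i k y, a i k y ≤ 1)
    {σ2 : ℝ} (hσ : ∀ i, ∑ k, ∫ y, a i k y ^ 2 ∂(ν k) ≤ σ2) (hσ0 : 0 ≤ σ2)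
    {E : ℝ} (hE : ∫ x, maxSum a x ∂(Measure.pi ν) ≤ E) (hE0 : 0 ≤ E) {x : ℝ} (hx : 0 < x) :
    (Measure.pi ν).real {z | E + x / 2 + 2 * Real.sqrt (x * (E + σ2)) < maxSum a z}
      ≤ Real.exp (-x) := by
  obtain ⟨t, ht, hle⟩ := exists_chernoff_exponent hE0 hσ0 hx
  set B := E + x / 2 + 2 * Real.sqrt (x * (E + σ2))
  have hZ := BddMeas.maxSum ha
  have hint := ((hZ.const_mul t).exp).integrable (Measure.pi ν)
  have hL := cgf_le_of_entropy_le hZ (P := Measure.pi ν)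
    (fun s hs => entropy_exp_maxSum_le ha ha0 ha1 hσ hs.le) ht
  calc (Measure.pi ν).real {z | B < maxSum a z} ≤ (Measure.pi ν).real {z | B ≤ maxSum a z} :=
        measureReal_mono fun z (hz : B < maxSum a z) => hz.le
    _ ≤ Real.exp (-t * B + cgf (maxSum a) (Measure.pi ν) t) :=
        measure_ge_le_exp_cgf B ht.le hint
    _ ≤ Real.exp (-x) := by
        refine Real.exp_le_exp.2 ?_
        have : t * Real.exp t * (∫ x, maxSum a x ∂(Measure.pi ν) + σ2 * t / 2)
            ≤ t * Real.exp t * (E + σ2 * t / 2) :=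
          mul_le_mul_of_nonneg_left (by linarith) (by positivity)
        linarith

lemma maxSum_const_mul {c : ℝ} (hc : 0 ≤ c) (a : ι → ∀ k, Y k → ℝ) (x : ∀ k, Y k) :
    maxSum (fun i k y => c * a i k y) x = c * maxSum a x := by
  simp only [maxSum, ← Finset.mul_sum]
  exact (Real.mul_iSup_of_nonneg hc _).symm

/-- Talagrand's inequality for the maximum of finitely many sums of independent centered
variables bounded above by `M`, not necessarily identically distributed. -/
theorem measure_lt_maxSum_le {a : ι → ∀ k, Y k → ℝ} (ha : ∀ i k, BddMeas (a i k))
    (ha0 : ∀ i k, ∫ y, a i k y ∂(ν k) = 0) {M : ℝ} (hM : 0 ≤ M) (haM : ∀ i k y, a i k y ≤ M)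
    {σ2 : ℝ} (hσ : ∀ i, ∑ k, ∫ y, a i k y ^ 2 ∂(ν k) ≤ σ2) (hσ0 : 0 ≤ σ2)
    {E : ℝ} (hE : ∫ x, maxSum a x ∂(Measure.pi ν) ≤ E) (hE0 : 0 ≤ E) {x : ℝ} (hx : 0 < x) :
    (Measure.pi ν).real {z | E + M * x / 2 + 2 * Real.sqrt (x * (M * E + σ2)) < maxSum a z}
      ≤ Real.exp (-x) := by
  rcases hM.eq_or_lt with rfl | hM
  -- For M = 0 there is no rescaling, but all sums are nonpositive and the event is empty.
  · have : {z | E + 0 * x / 2 + 2 * Real.sqrt (x * (0 * E + σ2)) < maxSum a z} = ∅ := by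
      refine Set.eq_empty_of_forall_notMem fun z hz => ?_
      have h1 : maxSum a z ≤ 0 := ciSup_le fun i => Finset.sum_nonpos fun k _ => haM i k _
      have h2 := Real.sqrt_nonneg (x * (0 * E + σ2))
      have h3 : E + 0 * x / 2 + 2 * Real.sqrt (x * (0 * E + σ2)) < maxSum a z := hz
      linarith
    rw [this]
    simpa using (Real.exp_pos _).le
  · have hMi : 0 ≤ M⁻¹ := (inv_pos.2 hM).le
    have h := measure_lt_maxSum_le_of_le_one (ν := ν) (a := fun i k y => M⁻¹ * a i k y)
      (fun i k => (ha i k).const_mul _) (fun i k => by rw [integral_const_mul, ha0, mul_zero])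
      (fun i k y => by rw [inv_mul_le_iff₀ hM, mul_one]; exact haM i k y)
      (σ2 := M⁻¹ ^ 2 * σ2)
      (fun i => by
        simp only [mul_pow, integral_const_mul]
        rw [← Finset.mul_sum]
        exact mul_le_mul_of_nonneg_left (hσ i) (sq_nonneg _))
      (by positivity) (E := M⁻¹ * E)
      (by
        simp only [maxSum_const_mul hMi, integral_const_mul]
        exact mul_le_mul_of_nonneg_left hE hMi)
      (by positivity) hx
    refine le_trans (le_of_eq ?_) h
    congr 1
    ext z
    simp only [Set.mem_ofPred_eq, maxSum_const_mul hMi]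
    have e1 : x * (M⁻¹ * E + M⁻¹ ^ 2 * σ2) = M⁻¹ ^ 2 * (x * (M * E + σ2)) := by
      field_simp
    rw [e1, Real.sqrt_mul (sq_nonneg _), Real.sqrt_sq hMi]
    have e2 : M⁻¹ * E + x / 2 + 2 * (M⁻¹ * Real.sqrt (x * (M * E + σ2)))
        = M⁻¹ * (E + M * x / 2 + 2 * Real.sqrt (x * (M * E + σ2))) := by
      field_simp
    rw [e2]
    exact (mul_lt_mul_iff_right₀ (inv_pos.2 hM)).symm

/-- The maximum dominates any single sum, which has mean zero. -/
lemma integral_maxSum_nonneg {a : ι → ∀ k, Y k → ℝ} (ha : ∀ i k, BddMeas (a i k))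
    (ha0 : ∀ i k, ∫ y, a i k y ∂(ν k) = 0) : 0 ≤ ∫ x, maxSum a x ∂(Measure.pi ν) := by
  let i : ι := Classical.arbitrary ι
  have h : ∫ x, ∑ k, a i k (x k) ∂(Measure.pi ν) = 0 := by
    rw [integral_finsetSum _ fun k _ =>
      (((ha i k).comp (measurable_pi_apply k)).integrable (Measure.pi ν))]
    refine Finset.sum_eq_zero fun k _ => ?_
    rw [integral_comp_eval (ha i k).meas.aestronglyMeasurable, ha0]
  rw [← h]
  exact integral_mono ((BddMeas.coordSum ha i).integrable _) ((BddMeas.maxSum ha).integrable _)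
    fun x => le_maxSum a i x

/-- Averaging one coordinate decreases the expected maximum. -/
lemma integral_maxSum_update_le {w : ι → ∀ k, Y k → ℝ} (hw : ∀ i k, BddMeas (w i k)) (j : K) :
    ∫ x, maxSum (fun i => Function.update (w i) j fun _ => ∫ y, w i j y ∂(ν j)) x ∂(Measure.pi ν)
      ≤ ∫ x, maxSum w x ∂(Measure.pi ν) := by
  have hw' : ∀ i k, BddMeas (Function.update (w i) j (fun _ => ∫ y, w i j y ∂(ν j)) k) := by
    intro i k
    by_cases h : k = j
    · subst h; simpa using BddMeas.const _
    · simpa [Function.update_of_ne h] using hw i k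
  have hZ := BddMeas.maxSum hw
  rw [← integral_coordInt hZ j]
  refine integral_mono ((BddMeas.maxSum hw').integrable _) ((hZ.coordInt j).integrable _)
    fun x => ciSup_le fun i => ?_
  have hup : Measurable fun y : Y j => Function.update x j y := measurable_update x
  have hs : ∀ y, ∑ k, w i k (Function.update x j y k)
      = (∑ k ∈ Finset.univ.erase j, w i k (x k)) + w i j y := fun y => by
    rw [← Finset.sum_erase_add _ _ (Finset.mem_univ j), Function.update_self]
    congr 1
    refine Finset.sum_congr rfl fun k hk => ?_
    rw [Function.update_of_ne (Finset.ne_of_mem_erase hk)]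
  have e : ∑ k, Function.update (w i) j (fun _ => ∫ y, w i j y ∂(ν j)) k (x k)
      = ∫ y, ∑ k, w i k (Function.update x j y k) ∂(ν j) := by
    simp only [hs]
    rw [integral_add (integrable_const _) ((hw i j).integrable _),
      ← Finset.sum_erase_add _ _ (Finset.mem_univ j), Function.update_self]
    simp only [integral_const, probReal_univ, smul_eq_mul, one_mul]
    congr 1
    refine Finset.sum_congr rfl fun k hk => ?_
    rw [Function.update_of_ne (Finset.ne_of_mem_erase hk)]
  rw [e]
  exact integral_mono (((BddMeas.coordSum hw i).comp hup).integrable _)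
    ((hZ.comp hup).integrable _) fun y => le_maxSum w i _

lemma integral_maxSum_averaged_le {w : ι → ∀ k, Y k → ℝ} (hw : ∀ i k, BddMeas (w i k))
    (J : Finset K) :
    ∫ x, maxSum (fun i k y => if k ∈ J then ∫ z, w i k z ∂(ν k) else w i k y) x ∂(Measure.pi ν)
      ≤ ∫ x, maxSum w x ∂(Measure.pi ν) := by
  induction J using Finset.induction with
  | empty => simp
  | insert j J hj ih =>
    refine le_trans (le_of_eq ?_) ((integral_maxSum_update_le (ν := ν)
      (w := fun i k y => if k ∈ J then ∫ z, w i k z ∂(ν k) else w i k y) (fun i k => ?_) j).trans ih)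
    · congr 1; ext x
      congr 1; ext i k y
      by_cases h : k = j
      · subst h; simp [hj]
      · simp [h]
    · by_cases h : k ∈ J
      · simpa [h] using BddMeas.const _
      · simpa [h] using hw i k

/-- Symmetrization with a fixed vector of signs. -/
lemma integral_maxSum_centered_le {u : ι → ∀ k, Y k → ℝ} (hu : ∀ i k, BddMeas (u i k))
    {s : K → ℝ} (hs : ∀ k, s k = 1 ∨ s k = -1) :
    ∫ x, maxSum (fun i k y => u i k y - ∫ z, u i k z ∂(ν k)) x ∂(Measure.pi ν)
      ≤ ∫ x, maxSum (fun i k y => s k * u i k y) x ∂(Measure.pi ν)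
        + ∫ x, maxSum (fun i k y => -s k * u i k y) x ∂(Measure.pi ν) := by
  classical
  have hw1 : ∀ i k, BddMeas fun y => s k * u i k y := fun i k => (hu i k).const_mul _
  have hw2 : ∀ i k, BddMeas fun y => -s k * u i k y := fun i k => (hu i k).const_mul _
  -- No ghost sample is needed: in each of the two maxima the coordinates with coefficient -1 are
  -- replaced by their means, and the two resulting sums add up to the centered sum.
  have h1 := integral_maxSum_averaged_le (ν := ν) hw1 (Finset.univ.filter fun k => s k = -1)
  have h2 := integral_maxSum_averaged_le (ν := ν) hw2 (Finset.univ.filter fun k => ¬ s k = -1)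
  refine le_trans ?_ (add_le_add h1 h2)
  have hb : ∀ (J : Finset K) (w : ι → ∀ k, Y k → ℝ), (∀ i k, BddMeas (w i k)) → ∀ i k,
      BddMeas fun y => if k ∈ J then ∫ z, w i k z ∂(ν k) else w i k y := fun J w hw i k => by
    by_cases h : k ∈ J
    · simpa [h] using BddMeas.const _
    · simpa [h] using hw i k
  have hb1 := BddMeas.maxSum (hb (Finset.univ.filter fun k => s k = -1) _ hw1)
  have hb2 := BddMeas.maxSum (hb (Finset.univ.filter fun k => ¬ s k = -1) _ hw2)
  rw [← integral_add (hb1.integrable _) (hb2.integrable _)]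
  refine integral_mono ((BddMeas.maxSum fun i k => (hu i k).sub (.const _)).integrable _)
    ((hb1.add hb2).integrable _) fun x => ciSup_le fun i => ?_
  refine le_trans (le_of_eq ?_) (add_le_add (le_maxSum _ i x) (le_maxSum _ i x))
  rw [← Finset.sum_add_distrib]
  refine Finset.sum_congr rfl fun k _ => ?_
  rcases hs k with h | h
  · have : ¬ (1 : ℝ) = -1 := by norm_num
    simp [h, this, integral_neg]; ring
  · simp [h, integral_neg]; ring

end Maximum

/-! ### Rademacher signs. -/

lemma measurePreserving_neg_rademacherLaw :
    MeasurePreserving (fun s : ℝ => -s) rademacherLaw rademacherLaw := by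
  refine ⟨measurable_neg, ?_⟩
  unfold rademacherLaw
  rw [Measure.map_add _ _ measurable_neg, Measure.map_smul, Measure.map_smul,
    Measure.map_dirac' measurable_neg, Measure.map_dirac' measurable_neg, neg_neg, add_comm]

lemma ae_rademacherLaw : ∀ᵐ s ∂rademacherLaw, s = 1 ∨ s = -1 := by
  unfold rademacherLaw
  rw [ae_add_measure_iff]
  have hm : MeasurableSet {s : ℝ | s = 1 ∨ s = -1} :=
    (measurableSet_singleton (1 : ℝ)).union (measurableSet_singleton (-1 : ℝ))
  constructor <;> refine Measure.ae_smul_measure ((ae_dirac_iff hm).2 ?_) _ <;> simp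

/-- The law of a family of independent Rademacher variables. -/
noncomputable abbrev signLaw (K : Type*) [Fintype K] : Measure (K → ℝ) :=
  Measure.pi fun _ : K => rademacherLaw

lemma ae_signLaw (K : Type*) [Fintype K] : ∀ᵐ s ∂(signLaw K), ∀ k, s k = 1 ∨ s k = -1 := by
  rw [ae_all_iff]
  intro k
  exact (Measure.quasiMeasurePreserving_eval (fun _ : K => rademacherLaw) k).ae ae_rademacherLaw

lemma measurePreserving_neg_signLaw (K : Type*) [Fintype K] :
    MeasurePreserving (fun s : K → ℝ => fun k => -s k) (signLaw K) (signLaw K) :=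
  measurePreserving_pi _ _ fun _ => measurePreserving_neg_rademacherLaw

/-! ### Weighted Rademacher sums and the multi-task complexity. -/

variable {T : ℕ} {𝒳 : Fin T → Type*} {N : Fin T → ℕ}

/-- The weight `1 / (T Nₜ)` of the sample point `(t, i)`. -/
noncomputable def weight (N : Fin T → ℕ) (k : Σ t, Fin (N t)) : ℝ :=
  1 / (T : ℝ) * (1 / (N k.1 : ℝ))

lemma weight_nonneg (k : Σ t, Fin (N t)) : 0 ≤ weight N k := by
  unfold weight; positivity

lemma sum_weight_mul (h : ∀ t, Fin (N t) → ℝ) :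
    ∑ k : Σ t, Fin (N t), weight N k * h k.1 k.2
      = (1 / (T : ℝ)) * ∑ t, (1 / (N t : ℝ)) * ∑ i, h t i := by
  simp only [Fintype.sum_sigma, weight, Finset.mul_sum, mul_assoc]

lemma sum_weight_mul_const (hN : ∀ t, 0 < N t) (h : Fin T → ℝ) :
    ∑ k : Σ t, Fin (N t), weight N k * h k.1 = (1 / (T : ℝ)) * ∑ t, h t := by
  rw [sum_weight_mul fun t _ => h t]
  congr 1
  refine Finset.sum_congr rfl fun t _ => ?_
  have : (N t : ℝ) ≠ 0 := by exact_mod_cast (hN t).ne'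
  simp [this]

lemma sum_weight (hT : 0 < T) (hN : ∀ t, 0 < N t) : ∑ k, weight N k = 1 := by
  have h := sum_weight_mul_const hN fun _ => 1
  have : (T : ℝ) ≠ 0 := by exact_mod_cast hT.ne'
  simpa [this] using h

lemma weight_le {n : ℕ} (hn : 0 < n) (hT : 0 < T) (h : ∀ t, n ≤ N t) (k : Σ t, Fin (N t)) :
    weight N k ≤ 1 / (n * T) := by
  have h1 : (n : ℝ) ≤ N k.1 := by exact_mod_cast h k.1
  have h2 : (0 : ℝ) < n := by exact_mod_cast hn
  have h3 : (0 : ℝ) < T := by exact_mod_cast hT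
  unfold weight
  rw [div_mul_div_comm, one_mul, mul_comm (n : ℝ)]
  exact one_div_le_one_div_of_le (by positivity) (mul_le_mul_of_nonneg_left h1 h3.le)

/-- The Rademacher sum over the sample `z` with signs `s`. -/
noncomputable def radSum (s : (Σ t, Fin (N t)) → ℝ) (z : ∀ k : Σ t, Fin (N t), 𝒳 k.1)
    (f : ∀ t, 𝒳 t → ℝ) : ℝ :=
  ∑ k, s k * (weight N k * f k.1 (z k))

lemma abs_radSum_le (hT : 0 < T) (hN : ∀ t, 0 < N t) {s : (Σ t, Fin (N t)) → ℝ} {S b : ℝ}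
    (hs : ∀ k, |s k| ≤ S) (hS : 0 ≤ S)
    {f : ∀ t, 𝒳 t → ℝ} (hf : ∀ t z, |f t z| ≤ b) (z : ∀ k : Σ t, Fin (N t), 𝒳 k.1) :
    |radSum s z f| ≤ S * b := by
  calc |radSum s z f| ≤ ∑ k, |s k * (weight N k * f k.1 (z k))| := Finset.abs_sum_le_sum_abs _ _
    _ ≤ ∑ k, weight N k * (S * b) := Finset.sum_le_sum fun k _ => by
        rw [abs_mul, abs_mul, abs_of_nonneg (weight_nonneg k), mul_left_comm]
        exact mul_le_mul_of_nonneg_left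
          (mul_le_mul (hs k) (hf _ _) (abs_nonneg _) hS) (weight_nonneg k)
    _ = S * b := by rw [← Finset.sum_mul, sum_weight hT hN, one_mul]

/-- Needed for every real vector s, not only for signs: the sign law lives on real vectors, and the
supremum of an unbounded set takes the default value 0. -/
lemma bddAbove_radSum (hT : 0 < T) (hN : ∀ t, 0 < N t) {F : Set (∀ t, 𝒳 t → ℝ)} {b : ℝ}
    (hb : ∀ f ∈ F, ∀ t z, |f t z| ≤ b) (s : (Σ t, Fin (N t)) → ℝ)
    (z : ∀ k : Σ t, Fin (N t), 𝒳 k.1) :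
    BddAbove (Set.range fun f : F => radSum s z (f : ∀ t, 𝒳 t → ℝ)) := by
  refine ⟨(∑ k, |s k|) * b, ?_⟩
  rintro _ ⟨f, rfl⟩
  exact (le_abs_self _).trans (abs_radSum_le hT hN
    (fun k => Finset.single_le_sum (f := fun k => |s k|) (fun k _ => abs_nonneg _)
      (Finset.mem_univ k)) (Finset.sum_nonneg fun k _ => abs_nonneg _) (hb f f.2) z)

section

variable [∀ t, MeasurableSpace (𝒳 t)] {Ω : Type*} [MeasurableSpace Ω] {Pr : Measure Ω}
  {X : ∀ t, Fin (N t) → Ω → 𝒳 t}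

/-- The whole sample as a random point of the product space. -/
def sample (X : ∀ t, Fin (N t) → Ω → 𝒳 t) (ω : Ω) (k : Σ t, Fin (N t)) : 𝒳 k.1 := X k.1 k.2 ω

lemma rademacherComplexity_eq (F : Set (∀ t, 𝒳 t → ℝ)) :
    rademacherComplexity Pr X F = ∫ p : Ω × ((Σ t, Fin (N t)) → ℝ),
      (⨆ f : F, radSum p.2 (sample X p.1) (f : ∀ t, 𝒳 t → ℝ))
        ∂(Pr.prod (signLaw (Σ t, Fin (N t)))) := by
  unfold rademacherComplexity
  congr 1; ext p
  congr 1; ext f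
  rw [← sum_weight_mul fun t i => p.2 ⟨t, i⟩ * (f : ∀ t, 𝒳 t → ℝ) t (X t i p.1)]
  exact Finset.sum_congr rfl fun k _ => by simp only [sample]; ring

lemma measurable_sample (hX : ∀ t i, Measurable (X t i)) : Measurable (sample X) :=
  measurable_pi_iff.2 fun k => hX k.1 k.2

lemma map_sample {μ : ∀ t, Measure (𝒳 t)} [∀ t, IsProbabilityMeasure (μ t)]
    [IsProbabilityMeasure Pr] (hX : ∀ t i, Measurable (X t i))
    (hlaw : ∀ t i, Pr.map (X t i) = μ t)
    (hindep : iIndepFun (fun k : (Σ t, Fin (N t)) => X k.1 k.2) Pr) :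
    Pr.map (sample X) = Measure.pi fun k : (Σ t, Fin (N t)) => μ k.1 := by
  have h := (iIndepFun_iff_map_fun_eq_pi_map fun k => (hX k.1 k.2).aemeasurable).1 hindep
  simp only [hlaw] at h
  exact h

lemma measurable_radSum (hX : ∀ t i, Measurable (X t i)) {f : ∀ t, 𝒳 t → ℝ}
    (hf : ∀ t, Measurable (f t)) :
    Measurable fun p : Ω × ((Σ t, Fin (N t)) → ℝ) => radSum p.2 (sample X p.1) f := by
  unfold radSum
  refine Finset.measurable_fun_sum _ fun k _ => ?_
  refine ((measurable_pi_apply k).comp measurable_snd).mul (measurable_const.mul ?_)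
  exact (hf k.1).comp ((hX k.1 k.2).comp measurable_fst)

/-- Reduction to a countable supremum, for measurability; a Rademacher sum involves finitely many
point evaluations, so it is continuous under pointwise limits. -/
lemma iSup_radSum_eq (hT : 0 < T) (hN : ∀ t, 0 < N t) {F G : Set (∀ t, 𝒳 t → ℝ)}
    (hFne : F.Nonempty) (hGF : G ⊆ F)
    (hlim : ∀ f ∈ F, ∃ g : ℕ → (∀ t, 𝒳 t → ℝ), (∀ m, g m ∈ G) ∧
      ∀ t z, Tendsto (fun m => g m t z) atTop (𝓝 (f t z)))
    {b : ℝ} (hb : ∀ f ∈ F, ∀ t z, |f t z| ≤ b) (s : (Σ t, Fin (N t)) → ℝ)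
    (z : ∀ k : Σ t, Fin (N t), 𝒳 k.1) :
    (⨆ f : F, radSum s z (f : ∀ t, 𝒳 t → ℝ)) = ⨆ f : G, radSum s z (f : ∀ t, 𝒳 t → ℝ) := by
  have : Nonempty F := hFne.to_subtype
  have hbG := bddAbove_radSum hT hN (fun f hf => hb f (hGF hf)) s z
  have hbF := bddAbove_radSum hT hN hb s z
  have : Nonempty G := by
    obtain ⟨f, hf⟩ := hFne
    obtain ⟨g, hg, -⟩ := hlim f hf
    exact ⟨⟨g 0, hg 0⟩⟩
  refine le_antisymm (ciSup_le fun f => ?_) (ciSup_le fun f => ?_)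
  · obtain ⟨g, hg, hgf⟩ := hlim f f.2
    have ht : Tendsto (fun m => radSum s z (g m)) atTop (𝓝 (radSum s z (f : ∀ t, 𝒳 t → ℝ))) :=
      tendsto_finsetSum _ fun k _ => ((hgf k.1 (z k)).const_mul _).const_mul _
    exact le_of_tendsto' ht fun m =>
      le_ciSup (f := fun f : G => radSum s z (f : ∀ t, 𝒳 t → ℝ)) hbG ⟨g m, hg m⟩
  · exact le_ciSup (f := fun f : F => radSum s z (f : ∀ t, 𝒳 t → ℝ)) hbF ⟨f, hGF f.2⟩

lemma integrable_iSup_radSum [IsProbabilityMeasure Pr] (hT : 0 < T) (hN : ∀ t, 0 < N t)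
    (hX : ∀ t i, Measurable (X t i)) {F : Set (∀ t, 𝒳 t → ℝ)} (hFne : F.Nonempty)
    (hF : PointwiseMeasurable F) {b : ℝ} (hb : ∀ f ∈ F, ∀ t z, |f t z| ≤ b) :
    Integrable (fun p : Ω × ((Σ t, Fin (N t)) → ℝ) =>
      ⨆ f : F, radSum p.2 (sample X p.1) (f : ∀ t, 𝒳 t → ℝ))
      (Pr.prod (signLaw (Σ t, Fin (N t)))) := by
  obtain ⟨hmeas, G, hGF, hGc, hlim⟩ := hF
  have hm : Measurable fun p : Ω × ((Σ t, Fin (N t)) → ℝ) =>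
      ⨆ f : F, radSum p.2 (sample X p.1) (f : ∀ t, 𝒳 t → ℝ) := by
    simp only [iSup_radSum_eq hT hN hFne hGF hlim hb]
    have : Countable G := hGc.to_subtype
    exact Measurable.iSup fun f => measurable_radSum hX (hmeas f (hGF f.2))
  refine Integrable.of_bound hm.aestronglyMeasurable b ?_
  have hae : ∀ᵐ p ∂(Pr.prod (signLaw (Σ t, Fin (N t)))), ∀ k, p.2 k = 1 ∨ p.2 k = -1 :=
    Measure.quasiMeasurePreserving_snd.ae (ae_signLaw _)
  filter_upwards [hae] with p hp
  have : Nonempty F := hFne.to_subtype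
  have h1 : ∀ f : F, |radSum p.2 (sample X p.1) (f : ∀ t, 𝒳 t → ℝ)| ≤ b := fun f => by
    have := abs_radSum_le hT hN (s := p.2) (S := 1)
      (fun k => by rcases hp k with h | h <;> simp [h]) zero_le_one (hb f f.2) (sample X p.1)
    simpa using this
  rw [Real.norm_eq_abs, abs_le]
  let f : F := Classical.arbitrary F
  exact ⟨(abs_le.1 (h1 f)).1.trans (le_ciSup (f := fun f : F =>
    radSum p.2 (sample X p.1) (f : ∀ t, 𝒳 t → ℝ)) (bddAbove_radSum hT hN hb _ _) f),
    ciSup_le fun f => (abs_le.1 (h1 f)).2⟩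

/-- Symmetrization: the expected maximal deviation over a finite subfamily is at most twice the
Rademacher complexity. -/
lemma integral_maxSum_le_rademacherComplexity {μ : ∀ t, Measure (𝒳 t)}
    [∀ t, IsProbabilityMeasure (μ t)] [IsProbabilityMeasure Pr] (hT : 0 < T) (hN : ∀ t, 0 < N t)
    (hX : ∀ t i, Measurable (X t i)) (hlaw : ∀ t i, Pr.map (X t i) = μ t)
    (hindep : iIndepFun (fun k : (Σ t, Fin (N t)) => X k.1 k.2) Pr)
    {F : Set (∀ t, 𝒳 t → ℝ)} (hFne : F.Nonempty)
    (hF : PointwiseMeasurable F) {b : ℝ} (hb : ∀ f ∈ F, ∀ t z, |f t z| ≤ b)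
    {ι : Type*} [Fintype ι] [Nonempty ι] (g : ι → F) {ε : ℝ} (hε : ε = 1 ∨ ε = -1) :
    ∫ z, maxSum (fun i (k : Σ t, Fin (N t)) y =>
        ε * (weight N k * (g i : ∀ t, 𝒳 t → ℝ) k.1 y)
          - ∫ y, ε * (weight N k * (g i : ∀ t, 𝒳 t → ℝ) k.1 y) ∂(μ k.1)) z
        ∂(Measure.pi fun k : (Σ t, Fin (N t)) => μ k.1)
      ≤ 2 * rademacherComplexity Pr X F := by
  have hb0 : ∀ i (k : Σ t, Fin (N t)),
      BddMeas fun y => weight N k * (g i : ∀ t, 𝒳 t → ℝ) k.1 y := fun i k =>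
    BddMeas.const_mul _ ⟨hF.1 _ (g i).2 k.1, b, hb _ (g i).2 k.1⟩
  let ρ : ((Σ t, Fin (N t)) → ℝ) → ℝ := fun s =>
    ∫ ω, maxSum (fun i (k : Σ t, Fin (N t)) y =>
      s k * (weight N k * (g i : ∀ t, 𝒳 t → ℝ) k.1 y)) (sample X ω) ∂Pr
  have hρ : ∀ s, ρ s = ∫ z, maxSum (fun i (k : Σ t, Fin (N t)) y =>
      s k * (weight N k * (g i : ∀ t, 𝒳 t → ℝ) k.1 y)) z
      ∂(Measure.pi fun k : (Σ t, Fin (N t)) => μ k.1) := fun s => by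
    rw [← map_sample hX hlaw hindep, integral_map (measurable_sample hX).aemeasurable
      (BddMeas.maxSum fun i k => (hb0 i k).const_mul _).meas.aestronglyMeasurable]
  let Q := signLaw (Σ t, Fin (N t))
  let H : Ω × ((Σ t, Fin (N t)) → ℝ) → ℝ := fun p =>
    ⨆ i, radSum p.2 (sample X p.1) (g i : ∀ t, 𝒳 t → ℝ)
  have hae : ∀ᵐ p ∂(Pr.prod Q), ∀ k, p.2 k = 1 ∨ p.2 k = -1 :=
    Measure.quasiMeasurePreserving_snd.ae (ae_signLaw _)
  have hHint : Integrable H (Pr.prod Q) := by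
    refine Integrable.of_bound
      (Measurable.iSup fun i => measurable_radSum hX (hF.1 _ (g i).2)).aestronglyMeasurable b ?_
    filter_upwards [hae] with p hp
    obtain ⟨i, hi⟩ := exists_eq_ciSup_of_finite
      (f := fun i => radSum p.2 (sample X p.1) (g i : ∀ t, 𝒳 t → ℝ))
    change |⨆ i, radSum p.2 (sample X p.1) (g i : ∀ t, 𝒳 t → ℝ)| ≤ b
    rw [← hi]
    have := abs_radSum_le hT hN (s := p.2) (S := 1)
      (fun k => by rcases hp k with h | h <;> simp [h]) zero_le_one (hb _ (g i).2) (sample X p.1)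
    simpa using this
  have hHρ : ∫ p, H p ∂(Pr.prod Q) = ∫ s, ρ s ∂Q := integral_prod_symm _ hHint
  have hρint : Integrable ρ Q := hHint.integral_prod_right
  have hHR : ∫ s, ρ s ∂Q ≤ rademacherComplexity Pr X F := by
    rw [rademacherComplexity_eq, ← hHρ]
    refine integral_mono hHint (integrable_iSup_radSum hT hN hX hFne hF hb) fun p => ?_
    exact ciSup_le fun i => le_ciSup (f := fun f : F =>
      radSum p.2 (sample X p.1) (f : ∀ t, 𝒳 t → ℝ)) (bddAbove_radSum hT hN hb _ _) (g i)
  have hneg := measurePreserving_neg_signLaw (Σ t, Fin (N t))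
  have hρneg : ∫ s, ρ (fun k => -s k) ∂Q = ∫ s, ρ s ∂Q := by
    have h := integral_map (μ := Q) hneg.measurable.aemeasurable (f := ρ)
      (by rw [hneg.map_eq]; exact hρint.aestronglyMeasurable)
    rw [hneg.map_eq] at h
    exact h.symm
  have hρnegint : Integrable (fun s : (Σ t, Fin (N t)) → ℝ => ρ (fun k => -s k)) Q :=
    hneg.integrable_comp_of_integrable hρint
  set E := ∫ z, maxSum (fun i (k : Σ t, Fin (N t)) y =>
        ε * (weight N k * (g i : ∀ t, 𝒳 t → ℝ) k.1 y)
          - ∫ y, ε * (weight N k * (g i : ∀ t, 𝒳 t → ℝ) k.1 y) ∂(μ k.1)) z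
        ∂(Measure.pi fun k : (Σ t, Fin (N t)) => μ k.1) with hE
  -- The left side does not depend on s, so the inequality can be averaged over the signs; by
  -- symmetry of their law both terms then contribute equally.
  have hle : ∀ᵐ s ∂Q, E ≤ ρ s + ρ (fun k => -s k) := by
    filter_upwards [ae_signLaw _] with s hs
    have h := integral_maxSum_centered_le (ν := fun k : (Σ t, Fin (N t)) => μ k.1)
      (u := fun i (k : Σ t, Fin (N t)) y => ε * (weight N k * (g i : ∀ t, 𝒳 t → ℝ) k.1 y))
      (fun i k => (hb0 i k).const_mul _) (s := s) hs
    rw [hρ, hρ]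
    rcases hε with h1 | h1
    · simpa [hE, h1] using h
    · rw [add_comm]; simpa [hE, h1] using h
  have h := integral_mono_ae (integrable_const E) (hρint.add hρnegint) hle
  have h2 : ∫ s, (ρ + fun s : (Σ t, Fin (N t)) → ℝ => ρ (fun k => -s k)) s ∂Q = ∫ s, ρ s ∂Q + ∫ s, ρ s ∂Q := by
    rw [integral_add' hρint hρnegint, hρneg]
  rw [h2] at h
  simp at h
  linarith

end

/-! ### Deviations of empirical means over finite subfamilies. -/

variable [∀ t, MeasurableSpace (𝒳 t)] {μ : ∀ t, Measure (𝒳 t)} [∀ t, IsProbabilityMeasure (μ t)]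
  {Ω : Type*} [MeasurableSpace Ω] {Pr : Measure Ω} {X : ∀ t, Fin (N t) → Ω → 𝒳 t}

/-- The contribution of one sample point to the signed deviation `ε (P_N f - P f)`. -/
noncomputable def deviation (μ : ∀ t, Measure (𝒳 t)) (N : Fin T → ℕ) (ε : ℝ)
    (f : ∀ t, 𝒳 t → ℝ) (k : Σ t, Fin (N t)) (y : 𝒳 k.1) : ℝ :=
  ε * (weight N k * f k.1 y) - ∫ y, ε * (weight N k * f k.1 y) ∂(μ k.1)

lemma deviation_eq (ε : ℝ) (f : ∀ t, 𝒳 t → ℝ) (k : Σ t, Fin (N t)) (y : 𝒳 k.1) :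
    deviation μ N ε f k y = ε * (weight N k * (f k.1 y - ∫ y, f k.1 y ∂(μ k.1))) := by
  unfold deviation
  rw [integral_const_mul, integral_const_mul]; ring

lemma sum_deviation (hN : ∀ t, 0 < N t) (ε : ℝ) (f : ∀ t, 𝒳 t → ℝ) (ω : Ω) :
    ∑ k, deviation μ N ε f k (sample X ω k)
      = ε * (empMean (fun t i => X t i ω) f - mean μ f) := by
  have h1 := sum_weight_mul (N := N) fun t i => f t (X t i ω)
  have h2 := sum_weight_mul_const hN fun t => ∫ y, f t y ∂(μ t)
  simp only [deviation_eq, mul_sub, Finset.sum_sub_distrib, ← Finset.mul_sum, sample]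
  rw [h1, h2]
  rfl

lemma bddMeas_deviation {f : ∀ t, 𝒳 t → ℝ} (hf : ∀ t, BddMeas (f t)) (ε : ℝ)
    (k : Σ t, Fin (N t)) : BddMeas (deviation μ N ε f k) :=
  (((hf k.1).const_mul _).const_mul _).sub (.const _)

lemma integral_deviation {f : ∀ t, 𝒳 t → ℝ} (hf : ∀ t, BddMeas (f t)) (ε : ℝ)
    (k : Σ t, Fin (N t)) : ∫ y, deviation μ N ε f k y ∂(μ k.1) = 0 := by
  unfold deviation
  rw [integral_sub ((((hf k.1).const_mul _).const_mul _).integrable _) (integrable_const _)]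
  simp

lemma abs_integral_le_of_bound {Y : Type*} [MeasurableSpace Y] {ν : Measure Y}
    [IsProbabilityMeasure ν] {f : Y → ℝ} {b : ℝ} (hb : ∀ y, |f y| ≤ b) :
    |∫ y, f y ∂ν| ≤ b := by
  simpa using norm_integral_le_of_norm_le_const (μ := ν) (f := f) (C := b)
    (Eventually.of_forall hb)

/-- A value of f and its mean both lie in [-b, b], and the weight is at most 1/(nT). -/
lemma deviation_le {n : ℕ} (hn : 0 < n) (hT : 0 < T) (hnN : ∀ t, n ≤ N t) {ε : ℝ}
    (hε : ε = 1 ∨ ε = -1) {f : ∀ t, 𝒳 t → ℝ} {b : ℝ} (hb : ∀ t z, |f t z| ≤ b)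
    (k : Σ t, Fin (N t)) (y : 𝒳 k.1) : deviation μ N ε f k y ≤ 2 * b / (n * T) := by
  have h1 := abs_le.1 (hb k.1 y)
  have h2 := abs_le.1 (abs_integral_le_of_bound (ν := μ k.1) (hb k.1))
  have hb0 : 0 ≤ b := (abs_nonneg _).trans (hb k.1 y)
  have h3 : ε * (f k.1 y - ∫ y, f k.1 y ∂(μ k.1)) ≤ 2 * b := by
    rcases hε with rfl | rfl <;> linarith [h1.1, h1.2, h2.1, h2.2]
  rw [deviation_eq, mul_left_comm]
  calc weight N k * (ε * (f k.1 y - ∫ y, f k.1 y ∂(μ k.1)))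
      ≤ weight N k * (2 * b) := mul_le_mul_of_nonneg_left h3 (weight_nonneg k)
    _ ≤ 1 / (n * T) * (2 * b) :=
        mul_le_mul_of_nonneg_right (weight_le hn hT hnN k) (by linarith)
    _ = _ := by ring

/-- Of the two weight factors in the square, one is bounded by 1/(nT); the other averages the
variances over the tasks. -/
lemma sum_integral_deviation_sq_le {n : ℕ} (hn : 0 < n) (hT : 0 < T) (hnN : ∀ t, n ≤ N t)
    {ε : ℝ} (hε : ε = 1 ∨ ε = -1) {f : ∀ t, 𝒳 t → ℝ} (hf : ∀ t, BddMeas (f t)) {r : ℝ}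
    (hr : (1 / (T : ℝ)) * ∑ t, variance (f t) (μ t) ≤ r) :
    ∑ k : Σ t, Fin (N t), ∫ y, deviation μ N ε f k y ^ 2 ∂(μ k.1) ≤ r / (n * T) := by
  have hε2 : ε ^ 2 = 1 := by rcases hε with rfl | rfl <;> norm_num
  have e : ∀ k : Σ t, Fin (N t), ∫ y, deviation μ N ε f k y ^ 2 ∂(μ k.1)
      = weight N k * (weight N k * variance (f k.1) (μ k.1)) := fun k => by
    rw [variance_eq_integral (hf k.1).meas.aemeasurable, ← integral_const_mul,
      ← integral_const_mul]
    congr 1; ext y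
    rw [deviation_eq, mul_pow, hε2]; ring
  calc ∑ k : Σ t, Fin (N t), ∫ y, deviation μ N ε f k y ^ 2 ∂(μ k.1)
      = ∑ k : Σ t, Fin (N t), weight N k * (weight N k * variance (f k.1) (μ k.1)) :=
        Finset.sum_congr rfl fun k _ => e k
    _ ≤ ∑ k : Σ t, Fin (N t), 1 / (n * T) * (weight N k * variance (f k.1) (μ k.1)) :=
        Finset.sum_le_sum fun k _ => mul_le_mul_of_nonneg_right (weight_le hn hT hnN k)
          (mul_nonneg (weight_nonneg k) (variance_nonneg _ _))
    _ = 1 / (n * T) * ((1 / (T : ℝ)) * ∑ t, variance (f t) (μ t)) := by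
        rw [← Finset.mul_sum, sum_weight_mul_const (fun t => hn.trans_le (hnN t))
          fun t => variance (f t) (μ t)]
    _ ≤ 1 / (n * T) * r := mul_le_mul_of_nonneg_left hr (by positivity)
    _ = r / (n * T) := by ring

/-- Concentration of the maximal deviation over a finite subfamily. -/
lemma measure_exists_lt_deviation_le [IsProbabilityMeasure Pr] (hT : 0 < T)
    (hX : ∀ t i, Measurable (X t i)) (hlaw : ∀ t i, Pr.map (X t i) = μ t)
    (hindep : iIndepFun (fun k : (Σ t, Fin (N t)) => X k.1 k.2) Pr)
    {F : Set (∀ t, 𝒳 t → ℝ)} (hFne : F.Nonempty) (hF : PointwiseMeasurable F)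
    {b : ℝ} (hb0 : 0 ≤ b) (hb : ∀ f ∈ F, ∀ t z, |f t z| ≤ b)
    {r : ℝ} (hr0 : 0 ≤ r) (hr : ∀ f ∈ F, (1 / (T : ℝ)) * ∑ t, variance (f t) (μ t) ≤ r)
    {n : ℕ} (hn : 0 < n) (hnN : ∀ t, n ≤ N t) {x : ℝ} (hx : 0 < x)
    {ι : Type*} [Fintype ι] [Nonempty ι] (g : ι → F) {ε : ℝ} (hε : ε = 1 ∨ ε = -1) :
    0 ≤ rademacherComplexity Pr X F ∧
    Pr.real {ω | ∃ i, 2 * rademacherComplexity Pr X F + 2 * b / (n * T) * x / 2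
        + 2 * Real.sqrt (x * (2 * b / (n * T) * (2 * rademacherComplexity Pr X F) + r / (n * T)))
        < ε * (empMean (fun t i => X t i ω) (g i) - mean μ (g i))} ≤ Real.exp (-x) := by
  have hN : ∀ t, 0 < N t := fun t => hn.trans_le (hnN t)
  have hfb : ∀ i t, BddMeas ((g i : ∀ t, 𝒳 t → ℝ) t) := fun i t =>
    ⟨hF.1 _ (g i).2 t, b, hb _ (g i).2 t⟩
  let a : ι → ∀ k : Σ t, Fin (N t), 𝒳 k.1 → ℝ := fun i => deviation μ N ε (g i)
  have ha : ∀ i k, BddMeas (a i k) := fun i k => bddMeas_deviation (hfb i) ε k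
  have ha0 : ∀ i k, ∫ y, a i k y ∂(μ k.1) = 0 := fun i k => integral_deviation (hfb i) ε k
  have hE : ∫ z, maxSum a z ∂(Measure.pi fun k : (Σ t, Fin (N t)) => μ k.1)
      ≤ 2 * rademacherComplexity Pr X F :=
    integral_maxSum_le_rademacherComplexity hT hN hX hlaw hindep hFne hF hb g hε
  have hE0 := (integral_maxSum_nonneg ha ha0).trans hE
  refine ⟨by linarith, ?_⟩
  have h := measure_lt_maxSum_le (ν := fun k : (Σ t, Fin (N t)) => μ k.1) ha ha0
    (M := 2 * b / (n * T)) (by positivity)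
    (fun i k y => deviation_le hn hT hnN hε (hb _ (g i).2) k y)
    (fun i => sum_integral_deviation_sq_le hn hT hnN hε (hfb i) (hr _ (g i).2))
    (by positivity) hE hE0 hx
  rw [← map_sample hX hlaw hindep, map_measureReal_apply (measurable_sample hX)
    (measurableSet_lt measurable_const (BddMeas.maxSum ha).meas)] at h
  refine le_trans (measureReal_mono ?_) h
  rintro ω ⟨i, hi⟩
  refine lt_of_lt_of_le hi ?_
  rw [← sum_deviation hN]
  exact le_maxSum a i _

/-! ### Passage from finite subfamilies to the whole class. -/

lemma tendsto_empMean {f : ∀ t, 𝒳 t → ℝ} {g : ℕ → ∀ t, 𝒳 t → ℝ}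
    (hg : ∀ t z, Tendsto (fun m => g m t z) atTop (𝓝 (f t z))) (z : ∀ t, Fin (N t) → 𝒳 t) :
    Tendsto (fun m => empMean z (g m)) atTop (𝓝 (empMean z f)) :=
  (tendsto_finsetSum _ fun t _ =>
    (tendsto_finsetSum _ fun i _ => hg t (z t i)).const_mul _).const_mul _

lemma tendsto_mean {f : ∀ t, 𝒳 t → ℝ} {g : ℕ → ∀ t, 𝒳 t → ℝ} {b : ℝ}
    (hgm : ∀ m t, Measurable (g m t)) (hgb : ∀ m t z, |g m t z| ≤ b)
    (hg : ∀ t z, Tendsto (fun m => g m t z) atTop (𝓝 (f t z))) :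
    Tendsto (fun m => mean μ (g m)) atTop (𝓝 (mean μ f)) :=
  (tendsto_finsetSum _ fun t _ => tendsto_integral_of_dominated_convergence (fun _ => b)
    (fun m => (hgm m t).aestronglyMeasurable) (integrable_const _)
    (fun m => Eventually.of_forall fun z => hgb m t z)
    (Eventually.of_forall fun z => hg t z)).const_mul _

/-- Concentration of the supremum of the signed deviations over a pointwise measurable class. -/
theorem le_measure_iSup_deviation_le [IsProbabilityMeasure Pr] (hT : 0 < T)
    (hX : ∀ t i, Measurable (X t i)) (hlaw : ∀ t i, Pr.map (X t i) = μ t)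
    (hindep : iIndepFun (fun k : (Σ t, Fin (N t)) => X k.1 k.2) Pr)
    {F : Set (∀ t, 𝒳 t → ℝ)} (hFne : F.Nonempty) (hF : PointwiseMeasurable F)
    {b : ℝ} (hb0 : 0 ≤ b) (hb : ∀ f ∈ F, ∀ t z, |f t z| ≤ b)
    {r : ℝ} (hr0 : 0 ≤ r) (hr : ∀ f ∈ F, (1 / (T : ℝ)) * ∑ t, variance (f t) (μ t) ≤ r)
    {n : ℕ} (hn : 0 < n) (hnN : ∀ t, n ≤ N t) {x : ℝ} (hx : 0 < x)
    {ε : ℝ} (hε : ε = 1 ∨ ε = -1) :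
    1 - Real.exp (-x) ≤ Pr.real {ω |
      (⨆ f : F, ε * (empMean (fun t i => X t i ω) f - mean μ f)) ≤
        ⨅ α : Set.Ioi (0 : ℝ),
          (2 * (1 + (α : ℝ)) * rademacherComplexity Pr X F
            + 2 * Real.sqrt (x * r / (n * T))
            + (1 + 4 / (α : ℝ)) * (b * x / (n * T)))} := by
  obtain ⟨hmeas, G, hGF, hGc, hlim⟩ := id hF
  have hGne : G.Nonempty := by
    obtain ⟨f, hf⟩ := hFne
    obtain ⟨g, hg, -⟩ := hlim f hf
    exact ⟨g 0, hg 0⟩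
  obtain ⟨e, he⟩ := hGc.exists_eq_range hGne
  have heF : ∀ j, e j ∈ F := fun j => hGF (he ▸ Set.mem_range_self j)
  set R := rademacherComplexity Pr X F
  let B : ℝ := 2 * R + 2 * b / (n * T) * x / 2
        + 2 * Real.sqrt (x * (2 * b / (n * T) * (2 * R) + r / (n * T)))
  -- Exceedance by one of the first m + 1 members of the enumeration; the index set is never empty
  -- and the threshold B does not depend on m.
  let A : ℕ → Set Ω := fun m => {ω | ∃ i : Fin (m + 1),
    B < ε * (empMean (fun t i => X t i ω) (e i) - mean μ (e i))}
  have hfin := fun m : ℕ => measure_exists_lt_deviation_le hT hX hlaw hindep hFne hF hb0 hb hr0 hr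
    hn hnN hx (fun i : Fin (m + 1) => (⟨e i, heF i⟩ : F)) hε
  have hR0 : 0 ≤ R := (hfin 0).1
  have hA : ∀ m, Pr.real (A m) ≤ Real.exp (-x) := fun m => (hfin m).2
  have hAmono : Monotone A := by
    rintro m m' hmm ω ⟨i, hi⟩
    exact ⟨⟨i, by omega⟩, hi⟩
  have hAU : Pr.real (⋃ m, A m) ≤ Real.exp (-x) := by
    refine ENNReal.toReal_le_of_le_ofReal (Real.exp_pos _).le ?_
    rw [hAmono.measure_iUnion]
    exact iSup_le fun m => (ENNReal.le_ofReal_iff_toReal_le (measure_ne_top _ _)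
      (Real.exp_pos _).le).2 (hA m)
  -- Subadditivity is enough here, so the measurability of the exceedance events plays no role.
  have hcompl : 1 - Real.exp (-x) ≤ Pr.real (⋃ m, A m)ᶜ := by
    have h1 := measureReal_union_le (μ := Pr) (⋃ m, A m) (⋃ m, A m)ᶜ
    rw [Set.union_compl_self, probReal_univ] at h1
    linarith
  refine hcompl.trans (measureReal_mono fun ω hω => ?_)
  have hG : ∀ g ∈ G, ε * (empMean (fun t i => X t i ω) g - mean μ g) ≤ B := by
    intro g hg
    rw [he] at hg
    obtain ⟨j, rfl⟩ := hg
    by_contra h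
    exact hω (Set.mem_iUnion.2 ⟨j, ⟨⟨j, by omega⟩, not_le.1 h⟩⟩)
  have hFB : ∀ f : F, ε * (empMean (fun t i => X t i ω) f - mean μ f) ≤ B := by
    intro f
    obtain ⟨g, hg, hgf⟩ := hlim f f.2
    refine le_of_tendsto' (((tendsto_empMean hgf fun t i => X t i ω).sub
      (tendsto_mean (μ := μ) (fun m => hmeas _ (hGF (hg m))) (fun m => hb _ (hGF (hg m)))
        hgf)).const_mul ε) fun m => hG _ (hg m)
  have : Nonempty F := hFne.to_subtype
  have : Nonempty (Set.Ioi (0 : ℝ)) := ⟨⟨1, Set.mem_Ioi.2 one_pos⟩⟩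
  change (⨆ f : F, ε * (empMean (fun t i => X t i ω) f - mean μ f)) ≤ _
  refine (ciSup_le hFB).trans (le_ciInf fun α => ?_)
  have hα : (0 : ℝ) < α := α.2
  have hn' : (0 : ℝ) < n := by exact_mod_cast hn
  have hT' : (0 : ℝ) < T := by exact_mod_cast hT
  set c := b / (n * T) with hc
  have hc0 : 0 ≤ c := by positivity
  -- √(u + 4pq) ≤ √u + p + q with p = αR and q = cx/α. Doubled, this costs 2cx/α, half of the 4cx/α
  -- available.
  have hsq : Real.sqrt (x * (2 * b / (n * T) * (2 * R) + r / (n * T)))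
      ≤ Real.sqrt (x * r / (n * T)) + (α * R + c * x / α) := by
    have e1 : x * (2 * b / (n * T) * (2 * R) + r / (n * T))
        = x * r / (n * T) + 4 * (α * R) * (c * x / α) := by
      rw [hc]; field_simp; ring
    rw [e1]
    have hp : 0 ≤ α * R := by positivity
    have hq : 0 ≤ c * x / α := by positivity
    refine Real.sqrt_le_iff.2 ⟨by positivity, ?_⟩
    have hs := Real.sq_sqrt (show 0 ≤ x * r / (n * T) by positivity)
    nlinarith [Real.sqrt_nonneg (x * r / (n * T)), sq_nonneg (α * R - c * x / α),
      mul_nonneg (Real.sqrt_nonneg (x * r / (n * T))) (add_nonneg hp hq)]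
  have e2 : 2 * b / (n * T) * x / 2 = c * x := by rw [hc]; ring
  have e3 : (1 + 4 / (α : ℝ)) * (b * x / (n * T)) = c * x + 4 * (c * x / α) := by
    rw [hc]; ring
  have hq : 0 ≤ c * x / α := by positivity
  simp only [B]
  rw [e2, e3]
  linarith

end MTL

theorem theorem3p2
    {T : ℕ} (hT : 0 < T)
    {𝒳 : Fin T → Type*} [∀ t, MeasurableSpace (𝒳 t)]
    (μ : ∀ t, Measure (𝒳 t)) [∀ t, IsProbabilityMeasure (μ t)]
    (N : Fin T → ℕ) (hN : ∀ t, 0 < N t)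
    {Ω : Type*} [MeasurableSpace Ω] (Pr : Measure Ω) [IsProbabilityMeasure Pr]
    (X : ∀ t, Fin (N t) → Ω → 𝒳 t)
    (hXmeas : ∀ t i, Measurable (X t i))
    (hXlaw : ∀ t i, Pr.map (X t i) = μ t)
    (hXindep : iIndepFun (fun k : (Σ t, Fin (N t)) => X k.1 k.2) Pr)
    (F : Set (∀ t, 𝒳 t → ℝ)) (hFne : F.Nonempty)
    (hFmeas : MTL.PointwiseMeasurable F)
    (b : ℝ) (hb : ∀ f ∈ F, ∀ t z, |f t z| ≤ b)
    (r : ℝ) (hr : ∀ f ∈ F, (1 / (T : ℝ)) * ∑ t, variance (f t) (μ t) ≤ r)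
    (n : ℕ) (hn : n = ⨅ t, N t)
    (x : ℝ) (hx : 0 < x) :
    1 - Real.exp (-x) ≤ Pr.real {ω |
      (⨆ f : F, (MTL.mean μ f - MTL.empMean (fun t i => X t i ω) f)) ≤
        ⨅ α : Set.Ioi (0 : ℝ),
          (2 * (1 + (α : ℝ)) * MTL.rademacherComplexity Pr X F
            + 2 * Real.sqrt (x * r / (n * T))
            + (1 + 4 / (α : ℝ)) * (b * x / (n * T)))} ∧
    1 - Real.exp (-x) ≤ Pr.real {ω |
      (⨆ f : F, (MTL.empMean (fun t i => X t i ω) f - MTL.mean μ f)) ≤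
        ⨅ α : Set.Ioi (0 : ℝ),
          (2 * (1 + (α : ℝ)) * MTL.rademacherComplexity Pr X F
            + 2 * Real.sqrt (x * r / (n * T))
            + (1 + 4 / (α : ℝ)) * (b * x / (n * T)))} := by
  have : Nonempty (Fin T) := ⟨⟨0, hT⟩⟩
  have hnN : ∀ t, n ≤ N t := fun t => by rw [hn]; exact ciInf_le (OrderBot.bddBelow _) t
  have hn0 : 0 < n := by
    obtain ⟨t, ht⟩ := exists_eq_ciInf_of_finite (f := N)
    rw [hn, ← ht]; exact hN t
  obtain ⟨f, hf⟩ := hFne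
  have hb0 : 0 ≤ b := by
    obtain ⟨z⟩ := nonempty_of_isProbabilityMeasure (μ ⟨0, hT⟩)
    exact (abs_nonneg _).trans (hb f hf ⟨0, hT⟩ z)
  have hr0 : 0 ≤ r := le_trans
    (mul_nonneg (by positivity) (Finset.sum_nonneg fun t _ => variance_nonneg _ _)) (hr f hf)
  constructor
  -- The sign ε = -1 turns P_N f - P f into P f - P_N f.
  · have h := MTL.le_measure_iSup_deviation_le hT hXmeas hXlaw hXindep ⟨f, hf⟩ hFmeas hb0 hb hr0
      hr hn0 hnN hx (Or.inr rfl)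
    simpa only [neg_one_mul, neg_sub] using h
  · have h := MTL.le_measure_iSup_deviation_le hT hXmeas hXlaw hXindep ⟨f, hf⟩ hFmeas hb0 hb hr0
      hr hn0 hnN hx (Or.inl rfl)
    simpa only [one_mul] using h
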